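/- Let $\ell_x,\ell_y,\ell_z>0$, let $\Omega=[0,\ell_x]\times[0,\ell_y]\times[0,\ell_z]\subset\mathbb R^3$, and write $|\Omega|=\ell_x\ell_y\ell_z$. There is a constant $C'>0$, depending only on $\Omega$, such that the following holds. Let $\varepsilon>0$ and $\eta,\zeta\in\mathbb R$ with $\zeta>\frac1\varepsilon+\eta-1$. Then $$C_{\varepsilon,\eta,\zeta}:=\frac{\varepsilon+1-\eta+\zeta-\sqrt{(\varepsilon-1+\eta-\zeta)^2+4}}{6}>0 .$$ Let $u:\Omega\times[0,\infty)\to\mathbb R$ be a classical solution of the Swift--Hohenberg equation $$\frac{\partial u}{\partial t}=-\left(u^3+(1-\eta)u+\varepsilon\Delta^2u+2\Delta u\right)$$ with the boundary conditions $\nabla u\cdot\boldsymbol n=0$ and $\nabla(\Delta u)\cdot\boldsymbol n=0$ on $\partial\Omega$ (where $\boldsymbol n$ is the outward unit normal) and initial value $u(\cdot,0)=u_0$. Here "classical solution" means: the equation holds in the interior of $\Omega$ for all $t>0$, the boundary conditions hold for all $t>0$, the space derivatives of $u$ of order at most $4$ exist and are continuous on $\Omega\times(0,\infty)$, and those of order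 at most $2$ exist and are continuous on $\Omega\times[0,\infty)$. Put $$H(v):=\int_\Omega\left(\frac14v^4+\frac{1-\eta}2v^2+\frac\varepsilon2(\Delta v)^2-|\nabla v|^2\right)d\boldsymbol x .$$ Then $H(u_0)+\frac{\zeta^2}4|\Omega|\ge0$ and, for all $t\ge0$, $$\max_{(x,y,z)\in\Omega}|u(x,y,z,t)|\le\sqrt{\frac{C'^2}{C_{\varepsilon,\eta,\zeta}}\left(H(u_0)+\frac{\zeta^2}4|\Omega|\right)} .$$ -/

import Mathlib

open MeasureTheory Set
open scoped InnerProductSpace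

noncomputable section

namespace SwiftHohenberg

/-- Three-dimensional Euclidean space. -/
abbrev R3 : Type := EuclideanSpace ℝ (Fin 3)

/-- The closed box `[0, ℓ 0] × [0, ℓ 1] × [0, ℓ 2]`. -/
def box (ℓ : Fin 3 → ℝ) : Set R3 := {x | ∀ i, x i ∈ Icc 0 (ℓ i)}

/-- The energy
`∫_Ω (u⁴ / 4 + (1 - η) / 2 * u² + ε / 2 * (Δu)² - |∇u|²) dx` on the box `Ω`. Derivatives are
taken within the closed box, so that only the values on the box matter. -/
def energy (ε η : ℝ) (ℓ : Fin 3 → ℝ) (u : R3 → ℝ) : ℝ :=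
  ∫ x in box ℓ, (1 / 4 * u x ^ 4 + (1 - η) / 2 * u x ^ 2
    + ε / 2 * (InnerProductSpace.laplacianWithin u (box ℓ) x) ^ 2
    - ‖gradientWithin u (box ℓ) x‖ ^ 2)

/-- `∇f · n = 0` on the boundary of the box. On the faces `x i = 0` and `x i = ℓ i` the outward
unit normal is minus or plus the `i`-th unit vector; on edges and corners the condition is imposed
for the normal of every face through the point, which for a `C¹` function follows by continuity
from the condition in the interior of the faces. -/
def ZeroNormalDeriv (ℓ : Fin 3 → ℝ) (f : R3 → ℝ) : Prop :=
  ∀ x ∈ box ℓ, ∀ i : Fin 3, (x i = 0 ∨ x i = ℓ i) → gradientWithin f (box ℓ) x i = 0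

/-- `u` is a classical solution on `Ω × [0, ∞)`, with `u t x` the value at time `t` and point `x`,
of the equation `∂u/∂t = -(u³ + (1 - η) u + ε Δ²u + 2 Δu)`, with boundary conditions
`∇u · n = 0 = ∇(Δu) · n` and initial value `u₀`. For positive times `u` has space derivatives up
to order four that are jointly continuous in time and space up to the boundary of the box (by the
equation, this makes `∂u/∂t` continuous too); those up to order two, which are the ones occurring
in the energy, are jointly continuous down to `t = 0`. -/
structure IsClassicalSolution (ε η : ℝ) (ℓ : Fin 3 → ℝ) (u₀ : R3 → ℝ) (u : ℝ → R3 → ℝ) :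
    Prop where
  contDiffOn_four : ∀ t, 0 < t → ContDiffOn ℝ 4 (u t) (box ℓ)
  continuousOn_deriv_four : ∀ k : ℕ, k ≤ 4 →
    ContinuousOn (fun p : ℝ × R3 => iteratedFDerivWithin ℝ k (u p.1) (box ℓ) p.2)
      (Ioi 0 ×ˢ box ℓ)
  contDiffOn_two : ∀ t, 0 ≤ t → ContDiffOn ℝ 2 (u t) (box ℓ)
  continuousOn_deriv_two : ∀ k : ℕ, k ≤ 2 →
    ContinuousOn (fun p : ℝ × R3 => iteratedFDerivWithin ℝ k (u p.1) (box ℓ) p.2)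
      (Ici 0 ×ˢ box ℓ)
  equation : ∀ t, 0 < t → ∀ x ∈ interior (box ℓ),
    HasDerivAt (fun s => u s x)
      (-(u t x ^ 3 + (1 - η) * u t x
        + ε * InnerProductSpace.laplacianWithin
            (InnerProductSpace.laplacianWithin (u t) (box ℓ)) (box ℓ) x
        + 2 * InnerProductSpace.laplacianWithin (u t) (box ℓ) x)) t
  neumann : ∀ t, 0 < t → ZeroNormalDeriv ℓ (u t)
  neumann_laplacian : ∀ t, 0 < t →
    ZeroNormalDeriv ℓ (InnerProductSpace.laplacianWithin (u t) (box ℓ))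
  initial : ∀ x ∈ box ℓ, u 0 x = u₀ x

/-- The constant `C_{ε,η,ζ}`. -/
def coercivityConst (ε η ζ : ℝ) : ℝ :=
  (ε + 1 - η + ζ - √((ε - 1 + η - ζ) ^ 2 + 4)) / 6

end SwiftHohenberg

end

/-! The equation is the `L²` gradient flow of the energy `H`, and `H` controls the `H²` size of `u`,
which in dimension three controls its maximum.

Coercivity: under the Neumann condition `-∫|∇v|² = ∫ v Δv`, so the energy density becomes a
polynomial in `a = v` and `w = Δv`. Since `(a² - ζ)² ≥ 0`, adding `ζ²/4` bounds it below by the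
quadratic form `(1 - η + ζ)/2 * a² + a * w + ε/2 * w²`. Its smaller eigenvalue is `3/2 * C_{ε,η,ζ}`,
which is positive because `ε (1 - η + ζ) > 1` (`coercivityConst_mul_le`,
`coercivityConst_mul_integral_le`).

Embedding: the `k`-th cosine coefficient of `v` is that of `v - Δv` divided by `1 + λ_k`. As `∑ (1 +
λ_k)⁻²` converges in dimension three, Cauchy–Schwarz and Bessel make the cosine series of `v`
converge uniformly, with sum bounded by the `L²` norms of `v` and `Δv` (`exists_sq_le_integral`).

Dissipation: `dH/dt = -∫ (∂u/∂t)² ≤ 0` (`IsClassicalSolution.hasDerivAt_energy`). No derivative of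
`Δu` in time is assumed, so `H` is not differentiated under the integral; instead, symmetry of `εΔ²
+ 2Δ` writes `H(u s) - H(u t)` as an integral of `u s - u t` times a continuous factor
(`energy_sub_energy`). The boundary conditions are assumed only for `t > 0`; time zero is reached by
continuity. -/

namespace SwiftHohenberg

/-! ### The box, and derivatives within it -/

/-- The `i`-th partial derivative within the box. -/
noncomputable def pd (ℓ : Fin 3 → ℝ) (i : Fin 3) (f : R3 → ℝ) (x : R3) : ℝ :=
  fderivWithin ℝ f (box ℓ) x (EuclideanSpace.single i 1)

theorem box_eq_preimage (ℓ : Fin 3 → ℝ) :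
    box ℓ = EuclideanSpace.equiv (Fin 3) ℝ ⁻¹' (univ.pi fun i => Icc 0 (ℓ i)) := by
  ext x
  simp only [box, mem_ofPred_eq, mem_preimage, mem_univ_pi]
  rfl

theorem isCompact_box (ℓ : Fin 3 → ℝ) : IsCompact (box ℓ) := by
  rw [box_eq_preimage]
  exact (EuclideanSpace.equiv (Fin 3) ℝ).toHomeomorph.isCompact_preimage.2
    (isCompact_univ_pi fun i => isCompact_Icc)

theorem measurableSet_box (ℓ : Fin 3 → ℝ) : MeasurableSet (box ℓ) :=
  (isCompact_box ℓ).measurableSet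

theorem convex_box (ℓ : Fin 3 → ℝ) : Convex ℝ (box ℓ) := by
  rw [box_eq_preimage]
  exact (convex_pi fun i _ => convex_Icc 0 (ℓ i)).linear_preimage
    (EuclideanSpace.equiv (Fin 3) ℝ).toLinearMap

theorem interior_box (ℓ : Fin 3 → ℝ) :
    interior (box ℓ) = {x : R3 | ∀ i, x i ∈ Ioo 0 (ℓ i)} := by
  rw [box_eq_preimage]
  have := (EuclideanSpace.equiv (Fin 3) ℝ).toHomeomorph.preimage_interior
    (univ.pi fun i => Icc 0 (ℓ i))
  refine this.symm.trans ?_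
  rw [interior_pi_set finite_univ]
  ext x; simp

theorem nonempty_interior_box {ℓ : Fin 3 → ℝ} (hℓ : ∀ i, 0 < ℓ i) :
    (interior (box ℓ)).Nonempty := by
  rw [interior_box]
  refine ⟨WithLp.toLp 2 fun i => ℓ i / 2, fun i => ?_⟩
  have := hℓ i
  constructor <;> simp <;> linarith

theorem uniqueDiffOn_box {ℓ : Fin 3 → ℝ} (hℓ : ∀ i, 0 < ℓ i) : UniqueDiffOn ℝ (box ℓ) :=
  uniqueDiffOn_convex (convex_box ℓ) (nonempty_interior_box hℓ)

theorem box_subset_closure_interior {ℓ : Fin 3 → ℝ} (hℓ : ∀ i, 0 < ℓ i) :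
    box ℓ ⊆ closure (interior (box ℓ)) := by
  rw [(convex_box ℓ).closure_interior_eq_closure_of_nonempty_interior (nonempty_interior_box hℓ)]
  exact subset_closure

theorem ae_mem_interior_box (ℓ : Fin 3 → ℝ) :
    ∀ᵐ x ∂(volume.restrict (box ℓ)), x ∈ interior (box ℓ) := by
  have h0 : volume (frontier (box ℓ)) = 0 := (convex_box ℓ).addHaar_frontier volume
  rw [ae_restrict_iff' (measurableSet_box ℓ)]
  filter_upwards [measure_eq_zero_iff_ae_notMem.1 h0] with x hx hxb
  by_contra h
  exact hx ⟨subset_closure hxb, h⟩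

theorem integrableOn_box {ℓ : Fin 3 → ℝ} {f : R3 → ℝ} (hf : ContinuousOn f (box ℓ)) :
    IntegrableOn f (box ℓ) := hf.integrableOn_compact (isCompact_box ℓ)

theorem integrableOn_box_mul {ℓ : Fin 3 → ℝ} {f g : R3 → ℝ} (hf : ContinuousOn f (box ℓ))
    (hg : ContinuousOn g (box ℓ)) : IntegrableOn (fun x => f x * g x) (box ℓ) :=
  integrableOn_box (hf.mul hg)

theorem contDiffOn_pd {ℓ : Fin 3 → ℝ} (hℓ : ∀ i, 0 < ℓ i) {m n : WithTop ℕ∞} {f : R3 → ℝ}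
    (hf : ContDiffOn ℝ n f (box ℓ)) (hmn : m + 1 ≤ n) (i : Fin 3) :
    ContDiffOn ℝ m (pd ℓ i f) (box ℓ) :=
  (hf.fderivWithin (uniqueDiffOn_box hℓ) hmn).clm_apply contDiffOn_const

theorem pd_congr {ℓ : Fin 3 → ℝ} {f g : R3 → ℝ} (h : EqOn f g (box ℓ)) (i : Fin 3) :
    EqOn (pd ℓ i f) (pd ℓ i g) (box ℓ) := fun x hx => by
  simp only [pd, fderivWithin_congr h (h hx)]

theorem pd_mul {ℓ : Fin 3 → ℝ} (hℓ : ∀ i, 0 < ℓ i) {f g : R3 → ℝ}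
    (hf : ContDiffOn ℝ 1 f (box ℓ)) (hg : ContDiffOn ℝ 1 g (box ℓ)) (i : Fin 3) :
    EqOn (pd ℓ i fun x => f x * g x) (fun x => f x * pd ℓ i g x + pd ℓ i f x * g x) (box ℓ) := by
  intro x hx
  simp only [pd]
  rw [fderivWithin_fun_mul (uniqueDiffOn_box hℓ x hx) (hf.differentiableOn (by simp) x hx)
    (hg.differentiableOn (by simp) x hx)]
  simp [mul_comm]

theorem gradientWithin_apply (ℓ : Fin 3 → ℝ) (f : R3 → ℝ) (x : R3) (i : Fin 3) :
    gradientWithin f (box ℓ) x i = pd ℓ i f x := by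
  have := inner_gradientWithin_left (𝕜 := ℝ) (f := f) (s := box ℓ) (x := x)
    (y := EuclideanSpace.single i (1 : ℝ))
  rw [pd, ← this, EuclideanSpace.inner_single_right]
  simp

theorem norm_gradientWithin_sq (ℓ : Fin 3 → ℝ) (f : R3 → ℝ) (x : R3) :
    ‖gradientWithin f (box ℓ) x‖ ^ 2 = ∑ i, pd ℓ i f x ^ 2 := by
  rw [EuclideanSpace.norm_sq_eq]
  simp [gradientWithin_apply]

theorem pd_iteratedFDerivWithin {ℓ : Fin 3 → ℝ} (hℓ : ∀ i, 0 < ℓ i) {f : R3 → ℝ} {n : ℕ}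
    (hf : ContDiffOn ℝ (n + 1 : ℕ) f (box ℓ)) (m : Fin n → R3) (i : Fin 3) :
    EqOn (pd ℓ i fun x => iteratedFDerivWithin ℝ n f (box ℓ) x m)
      (fun x => iteratedFDerivWithin ℝ (n + 1) f (box ℓ) x
        (Fin.cons (EuclideanSpace.single i 1) m)) (box ℓ) := by
  intro x hx
  have hd := hf.differentiableOn_iteratedFDerivWithin (m := n) (by exact_mod_cast n.lt_succ_self)
    (uniqueDiffOn_box hℓ) x hx
  simp only [pd]
  rw [iteratedFDerivWithin_succ_apply_left]
  have := (hd.hasFDerivWithinAt.continuousMultilinear_apply_const m).fderivWithin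
    (uniqueDiffOn_box hℓ x hx)
  rw [this]
  simp

theorem pd_pd_eq {ℓ : Fin 3 → ℝ} (hℓ : ∀ i, 0 < ℓ i) {f : R3 → ℝ} {n : ℕ}
    (hf : ContDiffOn ℝ (n + 2 : ℕ) f (box ℓ)) (m : Fin n → R3) (i : Fin 3) :
    EqOn (pd ℓ i (pd ℓ i fun x => iteratedFDerivWithin ℝ n f (box ℓ) x m))
      (fun x => iteratedFDerivWithin ℝ (n + 2) f (box ℓ) x
        (Fin.cons (EuclideanSpace.single i 1) (Fin.cons (EuclideanSpace.single i 1) m)))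
      (box ℓ) :=
  ((pd_congr (pd_iteratedFDerivWithin hℓ (hf.of_le (by norm_cast; omega)) m i) i).trans
    (pd_iteratedFDerivWithin hℓ hf _ i))

theorem pd_eq_iteratedFDerivWithin {ℓ : Fin 3 → ℝ} (hℓ : ∀ i, 0 < ℓ i) {f : R3 → ℝ}
    (hf : ContDiffOn ℝ 1 f (box ℓ)) (i : Fin 3) :
    EqOn (pd ℓ i f) (fun x => iteratedFDerivWithin ℝ 1 f (box ℓ) x
        (Fin.cons (EuclideanSpace.single i 1) Fin.elim0)) (box ℓ) := by
  have := pd_iteratedFDerivWithin (n := 0) hℓ (by simpa using hf) Fin.elim0 i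
  simpa using this

theorem pd_pd_eq_iteratedFDerivWithin {ℓ : Fin 3 → ℝ} (hℓ : ∀ i, 0 < ℓ i) {f : R3 → ℝ}
    (hf : ContDiffOn ℝ 2 f (box ℓ)) (i : Fin 3) :
    EqOn (pd ℓ i (pd ℓ i f)) (fun x => iteratedFDerivWithin ℝ 2 f (box ℓ) x
        (fun _ => EuclideanSpace.single i 1)) (box ℓ) := by
  have := pd_pd_eq (n := 0) hℓ (by simpa using hf) Fin.elim0 i
  intro x hx
  have h := this hx
  simp only [iteratedFDerivWithin_zero_apply] at h
  rw [h]
  congr 1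
  ext j : 1
  fin_cases j <;> rfl

/-- The Laplacian within the box as a sum of second partial derivatives. -/
noncomputable abbrev lap (ℓ : Fin 3 → ℝ) (f : R3 → ℝ) : R3 → ℝ :=
  InnerProductSpace.laplacianWithin f (box ℓ)

theorem lap_eq_iteratedFDerivWithin {ℓ : Fin 3 → ℝ} (hℓ : ∀ i, 0 < ℓ i) (f : R3 → ℝ) :
    EqOn (lap ℓ f) (fun x => ∑ i, iteratedFDerivWithin ℝ 2 f (box ℓ) x
        (fun _ => EuclideanSpace.single i 1)) (box ℓ) := by
  intro x hx
  rw [lap, InnerProductSpace.laplacianWithin_eq_iteratedFDerivWithin_orthonormalBasis f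
    (uniqueDiffOn_box hℓ) hx (EuclideanSpace.basisFun (Fin 3) ℝ)]
  refine Finset.sum_congr rfl fun i _ => ?_
  congr 1
  ext j : 1
  fin_cases j <;> simp

theorem lap_eq {ℓ : Fin 3 → ℝ} (hℓ : ∀ i, 0 < ℓ i) {f : R3 → ℝ} (hf : ContDiffOn ℝ 2 f (box ℓ)) :
    EqOn (lap ℓ f) (fun x => ∑ i, pd ℓ i (pd ℓ i f) x) (box ℓ) := fun x hx => by
  rw [lap_eq_iteratedFDerivWithin hℓ f hx]
  exact Finset.sum_congr rfl fun i _ => (pd_pd_eq_iteratedFDerivWithin hℓ hf i hx).symm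

theorem contDiffOn_lap {ℓ : Fin 3 → ℝ} (hℓ : ∀ i, 0 < ℓ i) {m n : WithTop ℕ∞} {f : R3 → ℝ}
    (hf : ContDiffOn ℝ n f (box ℓ)) (hmn : m + 2 ≤ n) : ContDiffOn ℝ m (lap ℓ f) (box ℓ) := by
  have h2 : (m + 1) + 1 ≤ n := by rwa [add_assoc, one_add_one_eq_two]
  have : (2 : WithTop ℕ∞) ≤ n := le_trans (by simp) hmn
  refine ContDiffOn.congr ?_ (lap_eq hℓ (hf.of_le this))
  exact ContDiffOn.sum fun i _ => contDiffOn_pd hℓ (contDiffOn_pd hℓ hf h2 i) le_rfl i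

/-- Joint continuity in time and space is assumed for `iteratedFDerivWithin`; this formula carries
it over to `Δ²`. The order of differentiation is kept, so no symmetry of mixed derivatives is used.
-/
theorem lap_lap_eq_iteratedFDerivWithin {ℓ : Fin 3 → ℝ} (hℓ : ∀ i, 0 < ℓ i) {f : R3 → ℝ}
    (hf : ContDiffOn ℝ 4 f (box ℓ)) :
    EqOn (lap ℓ (lap ℓ f)) (fun x => ∑ i, ∑ j, iteratedFDerivWithin ℝ 4 f (box ℓ) x
        (Fin.cons (EuclideanSpace.single i 1) (Fin.cons (EuclideanSpace.single i 1)
          (fun _ => EuclideanSpace.single j 1)))) (box ℓ) := by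
  intro x hx
  have hu := uniqueDiffOn_box hℓ
  have h2 : ContDiffOn ℝ 2 (lap ℓ f) (box ℓ) := contDiffOn_lap hℓ hf (by norm_num)
  rw [lap_eq hℓ h2 hx]
  refine Finset.sum_congr rfl fun i _ => ?_
  have hC : ∀ j : Fin 3, ContDiffOn ℝ 2 (fun x => iteratedFDerivWithin ℝ 2 f (box ℓ) x
        (fun _ => EuclideanSpace.single j 1)) (box ℓ) := fun j =>
    (contDiffOn_pd hℓ (contDiffOn_pd hℓ hf (m := 3) (by norm_num) j) (by norm_num) j).congr
      (pd_pd_eq_iteratedFDerivWithin hℓ (hf.of_le (by norm_num)) j).symm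
  have hsum : ∀ g : Fin 3 → R3 → ℝ, (∀ j, ContDiffOn ℝ 1 (g j) (box ℓ)) →
      EqOn (pd ℓ i fun x => ∑ j, g j x) (fun x => ∑ j, pd ℓ i (g j) x) (box ℓ) := by
    intro g hg y hy
    simp only [pd]
    rw [fderivWithin_fun_sum (hu y hy) fun j _ => (hg j).differentiableOn (by simp) y hy]
    simp
  rw [((pd_congr ((pd_congr (lap_eq_iteratedFDerivWithin hℓ f) i).trans
    (hsum _ fun j => (hC j).of_le (by norm_num))) i).trans
    (hsum _ fun j => contDiffOn_pd hℓ (hC j) (by norm_num) i)) hx]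
  exact Finset.sum_congr rfl fun j _ => pd_pd_eq (n := 2) hℓ (by exact_mod_cast hf) _ i hx

/-! ### Divergence theorem and Green's identities on the box -/

theorem setIntegral_box_eq (ℓ : Fin 3 → ℝ) (f : R3 → ℝ) :
    ∫ x in box ℓ, f x = ∫ y in Icc 0 ℓ, f (WithLp.toLp 2 y) := by
  have hpre : (WithLp.toLp 2 : (Fin 3 → ℝ) → R3) ⁻¹' box ℓ = Icc 0 ℓ := by
    ext y
    simp [box, Pi.le_def, forall_and]
  rw [← hpre]
  exact ((PiLp.volume_preserving_toLp (Fin 3)).setIntegral_preimage_emb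
    (MeasurableEquiv.toLp 2 (Fin 3 → ℝ)).measurableEmbedding f (box ℓ)).symm

/-- Divergence theorem for the field `f eᵢ`: only the two faces orthogonal to `eᵢ` carry flux, and
`f` vanishes there. -/
theorem integral_pd_eq_zero {ℓ : Fin 3 → ℝ} (hℓ : ∀ i, 0 < ℓ i) {f : R3 → ℝ}
    (hf : ContDiffOn ℝ 1 f (box ℓ)) (i : Fin 3)
    (h0 : ∀ x ∈ box ℓ, (x i = 0 ∨ x i = ℓ i) → f x = 0) :
    ∫ x in box ℓ, pd ℓ i f x = 0 := by
  classical
  set T : (Fin 3 → ℝ) →L[ℝ] R3 := (EuclideanSpace.equiv (Fin 3) ℝ).symm.toContinuousLinearMap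
  have hT : ∀ y, T y = WithLp.toLp 2 y := fun y => rfl
  have hmem : ∀ {y}, y ∈ Icc 0 ℓ → T y ∈ box ℓ := fun {y} hy j => ⟨hy.1 j, hy.2 j⟩
  let F : Fin 3 → (Fin 3 → ℝ) → ℝ := fun j y => if j = i then f (T y) else 0
  let F' : Fin 3 → (Fin 3 → ℝ) → (Fin 3 → ℝ) →L[ℝ] ℝ := fun j y =>
    if j = i then (fderivWithin ℝ f (box ℓ) (T y)).comp T else 0
  have hsum : ∀ y, ∑ j, F' j y (Pi.single j 1) = pd ℓ i f (T y) := by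
    intro y
    rw [Finset.sum_eq_single i]
    · simp only [F', if_true, pd, ContinuousLinearMap.comp_apply]
      congr 1
    · intro j _ hj; simp [F', hj]
    · simp
  have hfc : ContinuousOn (fun y => f (T y)) (Icc 0 ℓ) :=
    hf.continuousOn.comp T.continuous.continuousOn fun y hy => hmem hy
  have hpc : ContinuousOn (fun y => pd ℓ i f (T y)) (Icc 0 ℓ) :=
    (contDiffOn_pd hℓ hf (m := 0) (by simp) i).continuousOn.comp T.continuous.continuousOn
      fun y hy => hmem hy
  have key := integral_divergence_of_hasFDerivAt_off_countable' (n := 2) 0 ℓ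
    (fun j => (hℓ j).le) F F' ∅ countable_empty ?_ ?_ ?_
  · simp only [hsum] at key
    rw [setIntegral_box_eq]
    refine Eq.trans key (Finset.sum_eq_zero fun j _ => ?_)
    by_cases hj : j = i
    · subst hj
      have hface : ∀ c : ℝ, (c = 0 ∨ c = ℓ j) → ∀ y ∈ Icc ((0 : Fin 3 → ℝ) ∘ j.succAbove)
          (ℓ ∘ j.succAbove), F j (j.insertNth c y) = 0 := by
        intro c hc y hy
        simp only [F, if_true]
        refine h0 _ (hmem ?_) ?_
        · have hcI : 0 ≤ c ∧ c ≤ ℓ j := by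
            rcases hc with rfl | rfl
            · exact ⟨le_rfl, (hℓ j).le⟩
            · exact ⟨(hℓ j).le, le_rfl⟩
          exact Fin.insertNth_mem_Icc.2 ⟨hcI, hy⟩
        · simpa [hT] using hc
      rw [setIntegral_congr_fun measurableSet_Icc (hface _ (Or.inr rfl)),
        setIntegral_congr_fun measurableSet_Icc (hface ((0 : Fin 3 → ℝ) j) (Or.inl rfl))]
      simp
    · simp [F, hj]
  · intro j
    by_cases hj : j = i
    · simpa [F, hj] using hfc
    · simpa [F, hj] using continuousOn_const
  · rintro y ⟨hy, -⟩ j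
    by_cases hj : j = i
    · simp only [F, F', hj, if_true]
      have hyi : T y ∈ interior (box ℓ) := by
        rw [interior_box]; exact fun k => hy k (mem_univ k)
      have hd := ((hf.differentiableOn (by simp) _
        (interior_subset hyi)).hasFDerivWithinAt.hasFDerivAt (mem_interior_iff_mem_nhds.1 hyi))
      exact hd.comp y T.hasFDerivAt
    · simpa [F, F', hj] using hasFDerivAt_const (0 : ℝ) y
  · simp only [hsum]
    exact hpc.integrableOn_Icc

theorem ZeroNormalDeriv.pd_eq_zero {ℓ : Fin 3 → ℝ} {f : R3 → ℝ} (h : ZeroNormalDeriv ℓ f)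
    {x : R3} (hx : x ∈ box ℓ) {i : Fin 3} (hi : x i = 0 ∨ x i = ℓ i) : pd ℓ i f x = 0 := by
  rw [← gradientWithin_apply]; exact h x hx i hi

/-- Integration by parts with boundary term `g ∂ᵢf`, killed by the Neumann condition. Keeping a
single direction is what later gives orthogonality of the cosine modes. -/
theorem integral_mul_pd_pd {ℓ : Fin 3 → ℝ} (hℓ : ∀ i, 0 < ℓ i) {f g : R3 → ℝ}
    (hf : ContDiffOn ℝ 2 f (box ℓ)) (hg : ContDiffOn ℝ 1 g (box ℓ)) (hn : ZeroNormalDeriv ℓ f)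
    (i : Fin 3) :
    ∫ x in box ℓ, g x * pd ℓ i (pd ℓ i f) x = -∫ x in box ℓ, pd ℓ i g x * pd ℓ i f x := by
  have hf1 : ContDiffOn ℝ 1 (pd ℓ i f) (box ℓ) := contDiffOn_pd hℓ hf (by norm_num) i
  have hf2 : ContDiffOn ℝ 0 (pd ℓ i (pd ℓ i f)) (box ℓ) := contDiffOn_pd hℓ hf1 (by norm_num) i
  have hg1 : ContDiffOn ℝ 0 (pd ℓ i g) (box ℓ) := contDiffOn_pd hℓ hg (by norm_num) i
  have h := integral_pd_eq_zero hℓ (hg.mul hf1) i fun x hx hi => by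
    simp [hn.pd_eq_zero hx hi]
  rw [setIntegral_congr_fun (measurableSet_box ℓ) (pd_mul hℓ hg hf1 i),
    integral_add (integrableOn_box_mul hg.continuousOn hf2.continuousOn)
    (integrableOn_box_mul hg1.continuousOn hf1.continuousOn)] at h
  linarith

theorem integral_mul_lap {ℓ : Fin 3 → ℝ} (hℓ : ∀ i, 0 < ℓ i) {f g : R3 → ℝ}
    (hf : ContDiffOn ℝ 2 f (box ℓ)) (hg : ContDiffOn ℝ 1 g (box ℓ)) (hn : ZeroNormalDeriv ℓ f) :
    ∫ x in box ℓ, g x * lap ℓ f x = -∫ x in box ℓ, ∑ i, pd ℓ i g x * pd ℓ i f x := by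
  have hf1 : ∀ i, ContDiffOn ℝ 1 (pd ℓ i f) (box ℓ) := contDiffOn_pd hℓ hf (by norm_num)
  have hf2 : ∀ i, ContDiffOn ℝ 0 (pd ℓ i (pd ℓ i f)) (box ℓ) := fun i =>
    contDiffOn_pd hℓ (hf1 i) (by norm_num) i
  have hg1 : ∀ i, ContDiffOn ℝ 0 (pd ℓ i g) (box ℓ) := contDiffOn_pd hℓ hg (by norm_num)
  rw [setIntegral_congr_fun (g := fun x => ∑ i, g x * pd ℓ i (pd ℓ i f) x) (measurableSet_box ℓ)
      fun x hx => by simp only [lap_eq hℓ hf hx, Finset.mul_sum],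
    integral_finsetSum _ fun i _ => integrableOn_box_mul hg.continuousOn (hf2 i).continuousOn,
    integral_finsetSum _ fun i _ =>
      integrableOn_box_mul (hg1 i).continuousOn (hf1 i).continuousOn, ← Finset.sum_neg_distrib]
  exact Finset.sum_congr rfl fun i _ => integral_mul_pd_pd hℓ hf hg hn i

/-- Green's second identity under Neumann boundary conditions. -/
theorem integral_mul_lap_comm {ℓ : Fin 3 → ℝ} (hℓ : ∀ i, 0 < ℓ i) {f g : R3 → ℝ}
    (hf : ContDiffOn ℝ 2 f (box ℓ)) (hg : ContDiffOn ℝ 2 g (box ℓ)) (hnf : ZeroNormalDeriv ℓ f)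
    (hng : ZeroNormalDeriv ℓ g) :
    ∫ x in box ℓ, g x * lap ℓ f x = ∫ x in box ℓ, f x * lap ℓ g x := by
  rw [integral_mul_lap hℓ hf (hg.of_le (by norm_num)) hnf,
    integral_mul_lap hℓ hg (hf.of_le (by norm_num)) hng]
  simp only [mul_comm]

theorem integral_norm_gradientWithin_sq {ℓ : Fin 3 → ℝ} (hℓ : ∀ i, 0 < ℓ i) {f : R3 → ℝ}
    (hf : ContDiffOn ℝ 2 f (box ℓ)) (hn : ZeroNormalDeriv ℓ f) :
    ∫ x in box ℓ, ‖gradientWithin f (box ℓ) x‖ ^ 2 = -∫ x in box ℓ, f x * lap ℓ f x := by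
  rw [integral_mul_lap hℓ hf (hf.of_le (by norm_num)) hn, neg_neg]
  simp only [norm_gradientWithin_sq]
  simp only [pow_two]

/-! ### Neumann eigenfunctions of the box -/

/-- The frequency of the `k`-th cosine in the `i`-th coordinate. -/
noncomputable def freq (ℓ : Fin 3 → ℝ) (k : Fin 3 → ℕ) (i : Fin 3) : ℝ := k i * (Real.pi / ℓ i)

/-- The Neumann eigenfunctions of the box. -/
noncomputable def cosMode (ℓ : Fin 3 → ℝ) (k : Fin 3 → ℕ) (x : R3) : ℝ :=
  ∏ i, Real.cos (freq ℓ k i * x i)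

/-- The Neumann eigenvalues of `-Δ` on the box. -/
noncomputable def eigenvalue (ℓ : Fin 3 → ℝ) (k : Fin 3 → ℕ) : ℝ := ∑ i, freq ℓ k i ^ 2

theorem eigenvalue_nonneg (ℓ : Fin 3 → ℝ) (k : Fin 3 → ℕ) : 0 ≤ eigenvalue ℓ k :=
  Finset.sum_nonneg fun _ _ => sq_nonneg _

theorem contDiff_coord (i : Fin 3) {n : WithTop ℕ∞} : ContDiff ℝ n fun x : R3 => x i :=
  (EuclideanSpace.proj (𝕜 := ℝ) i).contDiff

theorem contDiff_cosMode (ℓ : Fin 3 → ℝ) (k : Fin 3 → ℕ) {n : WithTop ℕ∞} :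
    ContDiff ℝ n (cosMode ℓ k) :=
  contDiff_prod fun i _ => (contDiff_const.mul (contDiff_coord i)).cos

theorem abs_cosMode_le_one (ℓ : Fin 3 → ℝ) (k : Fin 3 → ℕ) (x : R3) : |cosMode ℓ k x| ≤ 1 := by
  rw [cosMode, Finset.abs_prod]
  exact Finset.prod_le_one (fun _ _ => abs_nonneg _) fun i _ => Real.abs_cos_le_one _

/-- `R` is constant along `eᵢ`, so on that line the product is `ψ` times a constant and the claim is
one-variable calculus. -/
theorem pd_mul_of_forall_add_eq {ℓ : Fin 3 → ℝ} (hℓ : ∀ i, 0 < ℓ i) {i : Fin 3} {ψ : ℝ → ℝ}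
    {ψ' : ℝ} {R : R3 → ℝ} {x : R3} (hx : x ∈ box ℓ) (hψ : HasDerivAt ψ ψ' (x i))
    (hR : ∀ t : ℝ, R (x + t • EuclideanSpace.single i 1) = R x)
    (hd : DifferentiableAt ℝ (fun y : R3 => ψ (y i) * R y) x) :
    pd ℓ i (fun y => ψ (y i) * R y) x = ψ' * R x := by
  rw [pd, hd.fderivWithin (uniqueDiffOn_box hℓ x hx), ← hd.lineDeriv_eq_fderiv, lineDeriv]
  have h1 : HasDerivAt (fun t : ℝ => ψ (x i + t)) ψ' 0 := by
    apply HasDerivAt.comp_const_add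
    simpa using hψ
  have h2 := (h1.mul_const (R x)).deriv
  rw [← h2]
  congr 1
  ext t
  simp [hR]

/-- The product of the cosines in the coordinates other than `i`. -/
noncomputable def cosModeErase (ℓ : Fin 3 → ℝ) (k : Fin 3 → ℕ) (i : Fin 3) (x : R3) : ℝ :=
  ∏ j ∈ Finset.univ.erase i, Real.cos (freq ℓ k j * x j)

theorem cosMode_eq_mul (ℓ : Fin 3 → ℝ) (k : Fin 3 → ℕ) (i : Fin 3) (x : R3) :
    cosMode ℓ k x = Real.cos (freq ℓ k i * x i) * cosModeErase ℓ k i x :=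
  (Finset.mul_prod_erase _ _ (Finset.mem_univ i)).symm

theorem cosModeErase_add_smul (ℓ : Fin 3 → ℝ) (k : Fin 3 → ℕ) (i : Fin 3) (x : R3) (t : ℝ) :
    cosModeErase ℓ k i (x + t • EuclideanSpace.single i 1) = cosModeErase ℓ k i x := by
  refine Finset.prod_congr rfl fun j hj => ?_
  simp [Finset.ne_of_mem_erase hj]

theorem contDiff_cosModeErase (ℓ : Fin 3 → ℝ) (k : Fin 3 → ℕ) (i : Fin 3) {n : WithTop ℕ∞} :
    ContDiff ℝ n (cosModeErase ℓ k i) :=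
  contDiff_prod fun i _ => (contDiff_const.mul (contDiff_coord i)).cos

theorem pd_cosMode {ℓ : Fin 3 → ℝ} (hℓ : ∀ i, 0 < ℓ i) (k : Fin 3 → ℕ) (i : Fin 3) :
    EqOn (pd ℓ i (cosMode ℓ k))
      (fun x => -(Real.sin (freq ℓ k i * x i) * freq ℓ k i) * cosModeErase ℓ k i x) (box ℓ) := by
  intro x hx
  have h : cosMode ℓ k = fun y => Real.cos (freq ℓ k i * y i) * cosModeErase ℓ k i y :=
    funext (cosMode_eq_mul ℓ k i)
  rw [h]
  refine pd_mul_of_forall_add_eq (ψ := fun s => Real.cos (freq ℓ k i * s)) hℓ hx ?_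
    (cosModeErase_add_smul ℓ k i x) ?_
  · simpa using ((hasDerivAt_id (x i)).const_mul (freq ℓ k i)).cos
  · rw [← h]; exact (contDiff_cosMode ℓ k (n := 1)).differentiable (by simp) x

theorem pd_pd_cosMode {ℓ : Fin 3 → ℝ} (hℓ : ∀ i, 0 < ℓ i) (k : Fin 3 → ℕ) (i : Fin 3) :
    EqOn (pd ℓ i (pd ℓ i (cosMode ℓ k))) (fun x => -freq ℓ k i ^ 2 * cosMode ℓ k x) (box ℓ) := by
  intro x hx
  beta_reduce
  rw [pd_congr (pd_cosMode hℓ k i) i hx, cosMode_eq_mul ℓ k i x]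
  rw [pd_mul_of_forall_add_eq (ψ := fun s => -(Real.sin (freq ℓ k i * s) * freq ℓ k i))
    (ψ' := -freq ℓ k i ^ 2 * Real.cos (freq ℓ k i * x i)) hℓ hx ?_
    (cosModeErase_add_smul ℓ k i x) ?_]
  · ring
  · convert! ((((hasDerivAt_id (x i)).const_mul (freq ℓ k i)).sin).mul_const (freq ℓ k i)).neg
      using 1
    simp; ring
  · exact (((((contDiff_const.mul (contDiff_coord i)).sin.mul contDiff_const).neg).mul
      (contDiff_cosModeErase ℓ k i)).differentiable (n := 1) (by simp)) x

theorem zeroNormalDeriv_cosMode {ℓ : Fin 3 → ℝ} (hℓ : ∀ i, 0 < ℓ i) (k : Fin 3 → ℕ) :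
    ZeroNormalDeriv ℓ (cosMode ℓ k) := by
  intro x hx i hi
  rw [gradientWithin_apply, pd_cosMode hℓ k i hx]
  have h0 : Real.sin (freq ℓ k i * x i) = 0 := by
    rcases hi with hi | hi
    · simp [hi]
    · rw [hi, freq, mul_assoc, div_mul_cancel₀ _ (hℓ i).ne', Real.sin_nat_mul_pi]
  simp [h0]

theorem lap_cosMode {ℓ : Fin 3 → ℝ} (hℓ : ∀ i, 0 < ℓ i) (k : Fin 3 → ℕ) :
    EqOn (lap ℓ (cosMode ℓ k)) (fun x => -eigenvalue ℓ k * cosMode ℓ k x) (box ℓ) := by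
  intro x hx
  rw [lap_eq hℓ (contDiff_cosMode ℓ k).contDiffOn hx]
  simp only [pd_pd_cosMode hℓ k _ hx, eigenvalue]
  rw [← Finset.sum_mul, Finset.sum_neg_distrib]

/-- Distinct `k` and `m` may share the same Laplace eigenvalue. In a direction `i` where they
differ, however, they are eigenfunctions of the symmetric operator `∂ᵢ²` with different eigenvalues.
-/
theorem integral_cosMode_mul_eq_zero {ℓ : Fin 3 → ℝ} (hℓ : ∀ i, 0 < ℓ i) {k m : Fin 3 → ℕ}
    (hkm : k ≠ m) : ∫ x in box ℓ, cosMode ℓ k x * cosMode ℓ m x = 0 := by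
  obtain ⟨i, hi⟩ := Function.ne_iff.1 hkm
  have hC : ∀ k, ContDiffOn ℝ 2 (cosMode ℓ k) (box ℓ) := fun k => (contDiff_cosMode ℓ k).contDiffOn
  have h : ∀ k m, -freq ℓ m i ^ 2 * ∫ x in box ℓ, cosMode ℓ k x * cosMode ℓ m x =
      -∫ x in box ℓ, pd ℓ i (cosMode ℓ k) x * pd ℓ i (cosMode ℓ m) x := fun k m => by
    rw [← integral_mul_pd_pd hℓ (hC m) ((hC k).of_le (by norm_num))
      (zeroNormalDeriv_cosMode hℓ m), ← integral_const_mul]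
    refine setIntegral_congr_fun (measurableSet_box ℓ) fun x hx => ?_
    simp only [pd_pd_cosMode hℓ m i hx]
    ring
  have h1 := h k m
  have h2 := h m k
  simp only [mul_comm (cosMode ℓ m _), mul_comm (pd ℓ i (cosMode ℓ m) _)] at h2
  have h3 : (freq ℓ k i ^ 2 - freq ℓ m i ^ 2) *
      ∫ x in box ℓ, cosMode ℓ k x * cosMode ℓ m x = 0 := by linarith
  refine (mul_eq_zero.1 h3).resolve_left fun h4 => hi ?_
  have hp : 0 < Real.pi / ℓ i := div_pos Real.pi_pos (hℓ i)
  have h5 := (sq_eq_sq₀ (a := freq ℓ k i) (b := freq ℓ m i) (by unfold freq; positivity)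
    (by unfold freq; positivity)).1 (by linarith)
  exact_mod_cast mul_right_cancel₀ hp.ne' h5

theorem half_le_integral_cos_sq {L : ℝ} (hL : 0 < L) (n : ℕ) :
    L / 2 ≤ ∫ y in Icc 0 L, Real.cos (n * (Real.pi / L) * y) ^ 2 := by
  rw [integral_Icc_eq_integral_Ioc, ← intervalIntegral.integral_of_le hL.le]
  rcases Nat.eq_zero_or_pos n with rfl | hn
  · simp; linarith
  · have hc : (n : ℝ) * (Real.pi / L) ≠ 0 := by positivity
    rw [intervalIntegral.integral_comp_mul_left (fun y => Real.cos y ^ 2) hc, integral_cos_sq]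
    have : (n : ℝ) * (Real.pi / L) * L = n * Real.pi := by field_simp
    rw [this, Real.sin_nat_mul_pi]
    simp
    apply le_of_eq
    field_simp

theorem prod_half_le_integral_cosMode_sq {ℓ : Fin 3 → ℝ} (hℓ : ∀ i, 0 < ℓ i) (k : Fin 3 → ℕ) :
    ∏ i, ℓ i / 2 ≤ ∫ x in box ℓ, cosMode ℓ k x * cosMode ℓ k x := by
  have h : ∫ x in box ℓ, cosMode ℓ k x * cosMode ℓ k x =
      ∏ i, ∫ y in Icc 0 (ℓ i), Real.cos (k i * (Real.pi / ℓ i) * y) ^ 2 := by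
    rw [setIntegral_box_eq, ← integral_fintype_prod_eq_prod
      (f := fun i y => Real.cos (k i * (Real.pi / ℓ i) * y) ^ 2), ← Measure.restrict_pi_pi,
      ← volume_pi]
    simp only [cosMode, freq, Finset.prod_pow, ← pow_two]
    rw [show (univ.pi fun i => Icc 0 (ℓ i)) = Icc 0 ℓ from pi_univ_Icc 0 ℓ]
  rw [h]
  exact Finset.prod_le_prod (fun i _ => (half_pos (hℓ i)).le)
    fun i _ => half_le_integral_cos_sq (hℓ i) (k i)

/-! ### Summability over the spectrum -/

theorem summable_prod_pi {n : ℕ} {f : Fin n → ℕ → ℝ} (h0 : ∀ i k, 0 ≤ f i k)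
    (hf : ∀ i, Summable (f i)) : Summable fun k : Fin n → ℕ => ∏ i, f i (k i) := by
  induction n with
  | zero => exact Summable.of_finite
  | succ n ih =>
    rw [← (Fin.consEquiv fun _ : Fin (n + 1) => ℕ).summable_iff]
    have := (hf 0).mul_of_nonneg (ih (fun i => h0 i.succ) fun i => hf i.succ) (h0 0)
      fun k => Finset.prod_nonneg fun i _ => h0 _ _
    refine this.congr fun p => ?_
    simp [Fin.prod_univ_succ, Fin.consEquiv]

/-- Each factor `1 + freq²` is at most `1 + λ_k`, so their product is at most `(1 + λ_k)³`. Raised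
to the power `-2/3`, this dominates `(1 + λ_k)⁻²` by a product of three one-dimensional series with
terms of order `n ^ (-4/3)`. Dimension three enters through `4/3 > 1`. -/
theorem summable_one_div_one_add_eigenvalue_sq {ℓ : Fin 3 → ℝ} (hℓ : ∀ i, 0 < ℓ i) :
    Summable fun k => (1 / (1 + eigenvalue ℓ k)) ^ 2 := by
  have hp : ∀ i, 0 < Real.pi / ℓ i := fun i => div_pos Real.pi_pos (hℓ i)
  have h1 : ∀ i, Summable fun n : ℕ => (1 + (n * (Real.pi / ℓ i)) ^ 2) ^ (-(2 / 3) : ℝ) := by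
    intro i
    have hs : Summable fun n : ℕ =>
        ((Real.pi / ℓ i) ^ 2) ^ (-(2 / 3) : ℝ) * (n : ℝ) ^ (-(4 / 3) : ℝ) :=
      (Real.summable_nat_rpow.2 (by norm_num)).mul_left _
    refine Summable.of_norm_bounded_eventually_nat hs ?_
    filter_upwards [Filter.eventually_gt_atTop 0] with n hn
    have hn' : (0 : ℝ) < n := by exact_mod_cast hn
    rw [Real.norm_of_nonneg (by positivity)]
    have : (n : ℝ) ^ (-(4 / 3) : ℝ) = ((n : ℝ) ^ 2) ^ (-(2 / 3) : ℝ) := by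
      rw [← Real.rpow_natCast, ← Real.rpow_mul hn'.le]; norm_num
    have hpi := hp i
    rw [this, ← Real.mul_rpow (by positivity) (by positivity)]
    refine Real.rpow_le_rpow_of_nonpos (by positivity) ?_ (by norm_num)
    nlinarith
  refine Summable.of_nonneg_of_le (fun k => sq_nonneg _) (fun k => ?_)
    (summable_prod_pi (fun i k => by positivity) h1)
  have he := eigenvalue_nonneg ℓ k
  rw [Real.finsetProd_rpow _ _ (fun i _ => by positivity)]
  have hle : ∏ i, (1 + (k i * (Real.pi / ℓ i)) ^ 2) ≤ (1 + eigenvalue ℓ k) ^ 3 := by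
    calc ∏ i, (1 + (k i * (Real.pi / ℓ i)) ^ 2) ≤ ∏ _i : Fin 3, (1 + eigenvalue ℓ k) := by
          refine Finset.prod_le_prod (fun i _ => by positivity) fun i _ => ?_
          have := Finset.single_le_sum (f := fun i => freq ℓ k i ^ 2) (fun _ _ => sq_nonneg _)
            (Finset.mem_univ i)
          simpa [eigenvalue, freq] using this
      _ = _ := by simp
  have : (1 / (1 + eigenvalue ℓ k)) ^ 2 = ((1 + eigenvalue ℓ k) ^ 3) ^ (-(2 / 3) : ℝ) := by
    rw [← Real.rpow_natCast (1 + eigenvalue ℓ k) 3, ← Real.rpow_mul (by positivity), one_div,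
      inv_pow, ← Real.rpow_natCast, ← Real.rpow_neg (by positivity)]
    norm_num
  rw [this]
  exact Real.rpow_le_rpow_of_nonpos (Finset.prod_pos fun i _ => by positivity) hle (by norm_num)

/-! ### Completeness of the cosines in `L²` -/

instance compactSpace_box (ℓ : Fin 3 → ℝ) : CompactSpace (box ℓ) :=
  isCompact_iff_compactSpace.1 (isCompact_box ℓ)

/-- The volume measure on the box, as a subtype. -/
noncomputable def boxMeasure (ℓ : Fin 3 → ℝ) : Measure (box ℓ) :=
  (volume : Measure R3).comap Subtype.val

instance isFiniteMeasure_box (ℓ : Fin 3 → ℝ) : IsFiniteMeasure (boxMeasure ℓ) := by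
  refine ⟨?_⟩
  rw [boxMeasure, (MeasurableEmbedding.subtype_coe (measurableSet_box ℓ)).comap_apply, image_univ,
    Subtype.range_coe]
  exact (isCompact_box ℓ).measure_lt_top

/-- This makes the map from continuous functions to `L²` injective, so that an identity in `L²`
holds at every point of the closed box. -/
theorem isOpenPosMeasure_box {ℓ : Fin 3 → ℝ} (hℓ : ∀ i, 0 < ℓ i) :
    (boxMeasure ℓ).IsOpenPosMeasure := by
  refine ⟨fun U hU hne h0 => ?_⟩
  obtain ⟨O, hO, rfl⟩ := isOpen_induced_iff.1 hU
  obtain ⟨x, hx⟩ := hne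
  have h1 : (O ∩ interior (box ℓ)).Nonempty :=
    mem_closure_iff.1 (box_subset_closure_interior hℓ x.2) O hO hx
  have h2 := (hO.inter isOpen_interior).measure_pos (volume : Measure R3) h1
  rw [boxMeasure, (MeasurableEmbedding.subtype_coe
    (measurableSet_box ℓ)).comap_apply, Subtype.image_preimage_coe] at h0
  refine h2.ne' (measure_mono_null (fun y hy => ?_) h0)
  exact ⟨interior_subset hy.2, hy.1⟩

/-- The restriction to the box of a function that is continuous on the box. -/
def boxRestrict {ℓ : Fin 3 → ℝ} {f : R3 → ℝ} (hf : ContinuousOn f (box ℓ)) : C(box ℓ, ℝ) :=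
  ⟨(box ℓ).domRestrict f, continuousOn_iff_continuous_domRestrict.1 hf⟩

theorem continuous_cosMode (ℓ : Fin 3 → ℝ) (k : Fin 3 → ℕ) : Continuous (cosMode ℓ k) :=
  (contDiff_cosMode ℓ k (n := 0)).continuous

/-- The Neumann eigenfunctions as continuous functions on the box. -/
noncomputable def cosModeC (ℓ : Fin 3 → ℝ) (k : Fin 3 → ℕ) : C(box ℓ, ℝ) :=
  boxRestrict (continuous_cosMode ℓ k).continuousOn

theorem cosModeC_apply (ℓ : Fin 3 → ℝ) (k : Fin 3 → ℕ) (x : box ℓ) :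
    cosModeC ℓ k x = cosMode ℓ k x := rfl

theorem cosMode_update (ℓ : Fin 3 → ℝ) (k : Fin 3 → ℕ) (i : Fin 3) (n : ℕ) (x : R3) :
    cosMode ℓ (Function.update k i n) x =
      Real.cos (n * (Real.pi / ℓ i * x i)) * cosModeErase ℓ k i x := by
  rw [cosMode_eq_mul ℓ _ i]
  congr 1
  · simp [freq, mul_assoc]
  · refine Finset.prod_congr rfl fun j hj => ?_
    simp [freq, Function.update_of_ne (Finset.ne_of_mem_erase hj)]

theorem cosMode_zero (ℓ : Fin 3 → ℝ) (x : R3) : cosMode ℓ 0 x = 1 := by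
  simp [cosMode, freq]

theorem cosMode_single (ℓ : Fin 3 → ℝ) (i : Fin 3) (x : R3) :
    cosMode ℓ (Pi.single i 1) x = Real.cos (Real.pi / ℓ i * x i) := by
  rw [show (Pi.single i 1 : Fin 3 → ℕ) = Function.update (0 : Fin 3 → ℕ) i 1 from rfl, cosMode_update]
  simp [cosModeErase, freq]

/-- Product-to-sum: `2 cos t cos((n+1)t) = cos((n+2)t) + cos(nt)`. The frequency `0` is separate
because indices are natural numbers. -/
theorem cosModeC_single_mul_mem_span (ℓ : Fin 3 → ℝ) (i : Fin 3) (k : Fin 3 → ℕ) :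
    cosModeC ℓ (Pi.single i 1) * cosModeC ℓ k ∈ Submodule.span ℝ (range (cosModeC ℓ)) := by
  have hk : k = Function.update k i (k i) := (Function.update_eq_self i k).symm
  rcases h : k i with _ | n
  · have : cosModeC ℓ (Pi.single i 1) * cosModeC ℓ k = cosModeC ℓ (Function.update k i 1) := by
      ext x
      rw [hk, h]
      simp [cosModeC_apply, cosMode_single, cosMode_update]
    rw [this]
    exact Submodule.subset_span ⟨_, rfl⟩
  · have : cosModeC ℓ (Pi.single i 1) * cosModeC ℓ k =
        (1 / 2 : ℝ) • cosModeC ℓ (Function.update k i (n + 2)) +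
        (1 / 2 : ℝ) • cosModeC ℓ (Function.update k i n) := by
      ext x
      conv_lhs => rw [hk, h]
      simp only [ContinuousMap.mul_apply, ContinuousMap.add_apply, ContinuousMap.smul_apply,
        cosModeC_apply, cosMode_single, cosMode_update, smul_eq_mul]
      set t := Real.pi / ℓ i * (x : R3) i
      have h1 : ((n + 2 : ℕ) : ℝ) * t = ((n + 1 : ℕ) : ℝ) * t + t := by push_cast; ring
      have h2 : (n : ℝ) * t = ((n + 1 : ℕ) : ℝ) * t - t := by push_cast; ring
      rw [h1, h2, Real.cos_add, Real.cos_sub]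
      ring
    rw [this]
    exact add_mem (Submodule.smul_mem _ _ (Submodule.subset_span ⟨_, rfl⟩))
      (Submodule.smul_mem _ _ (Submodule.subset_span ⟨_, rfl⟩))

/-- The span is stable under multiplication by the generators, hence by the whole algebra, and it
contains `1`. -/
theorem adjoin_cosModeC_le_span (ℓ : Fin 3 → ℝ) {f : C(box ℓ, ℝ)}
    (hf : f ∈ Algebra.adjoin ℝ (range fun i : Fin 3 => cosModeC ℓ (Pi.single i 1))) :
    f ∈ Submodule.span ℝ (range (cosModeC ℓ)) := by
  have key : ∀ m ∈ Submodule.span ℝ (range (cosModeC ℓ)),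
      f * m ∈ Submodule.span ℝ (range (cosModeC ℓ)) := by
    induction hf using Algebra.adjoin_induction with
    | mem g hg =>
      obtain ⟨i, rfl⟩ := hg
      intro m hm
      induction hm using Submodule.span_induction with
      | mem m hm => obtain ⟨k, rfl⟩ := hm; exact cosModeC_single_mul_mem_span ℓ i k
      | zero => simp
      | add a b _ _ ha hb => rw [mul_add]; exact add_mem ha hb
      | smul c a _ ha => rw [mul_smul_comm]; exact Submodule.smul_mem _ _ ha
    | algebraMap r => intro m hm; rw [← Algebra.smul_def]; exact Submodule.smul_mem _ _ hm
    | add a b _ _ ha hb => intro m hm; rw [add_mul]; exact add_mem (ha m hm) (hb m hm)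
    | mul a b _ _ ha hb => intro m hm; rw [mul_assoc]; exact ha _ (hb m hm)
  have h1 : cosModeC ℓ 0 = 1 := by ext x; simp [cosModeC_apply, cosMode_zero]
  simpa [h1] using key (cosModeC ℓ 0) (Submodule.subset_span ⟨0, rfl⟩)

/-- Stone–Weierstrass: `cos(π xᵢ / ℓᵢ)` is injective in `xᵢ ∈ [0, ℓᵢ]`, so the three basic cosines
separate points. -/
theorem span_cosModeC_topologicalClosure {ℓ : Fin 3 → ℝ} (hℓ : ∀ i, 0 < ℓ i) :
    (Submodule.span ℝ (range (cosModeC ℓ))).topologicalClosure = ⊤ := by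
  have hsep : (Algebra.adjoin ℝ
      (range fun i : Fin 3 => cosModeC ℓ (Pi.single i 1))).SeparatesPoints := by
    intro x y hxy
    have : ∃ i, (x : R3) i ≠ (y : R3) i := by
      by_contra! h
      exact hxy (Subtype.ext (PiLp.ext h))
    obtain ⟨i, hi⟩ := this
    refine ⟨_, ⟨cosModeC ℓ (Pi.single i 1), Algebra.subset_adjoin ⟨i, rfl⟩, rfl⟩, fun h => hi ?_⟩
    simp only [cosModeC_apply, cosMode_single] at h
    have hp : 0 < Real.pi / ℓ i := div_pos Real.pi_pos (hℓ i)
    have hmem : ∀ z : box ℓ, Real.pi / ℓ i * (z : R3) i ∈ Icc 0 Real.pi := fun z => by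
      have hz := z.2 i
      refine ⟨mul_nonneg hp.le hz.1, ?_⟩
      calc Real.pi / ℓ i * (z : R3) i ≤ Real.pi / ℓ i * ℓ i := by gcongr; exact hz.2
        _ = Real.pi := div_mul_cancel₀ _ (hℓ i).ne'
    exact mul_left_cancel₀ hp.ne' (Real.injOn_cos (hmem x) (hmem y) h)
  rw [eq_top_iff]
  intro f _
  have h := ContinuousMap.continuousMap_mem_subalgebra_closure_of_separatesPoints _ hsep f
  exact closure_mono (fun g hg => adjoin_cosModeC_le_span ℓ hg) h

/-- Continuous functions on the box as elements of `L²`. -/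
noncomputable abbrev toL2 (ℓ : Fin 3 → ℝ) :
    C(box ℓ, ℝ) →L[ℝ] Lp ℝ 2 (boxMeasure ℓ) :=
  ContinuousMap.toLp 2 (boxMeasure ℓ) ℝ

theorem inner_toL2 {ℓ : Fin 3 → ℝ} {f g : R3 → ℝ} (hf : ContinuousOn f (box ℓ))
    (hg : ContinuousOn g (box ℓ)) :
    ⟪toL2 ℓ (boxRestrict hf), toL2 ℓ (boxRestrict hg)⟫_ℝ = ∫ x in box ℓ, f x * g x := by
  rw [ContinuousMap.inner_toLp, ← integral_subtype_comap (measurableSet_box ℓ)]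
  simp [boxRestrict, boxMeasure, mul_comm]

/-- The `L²` norm of the Neumann eigenfunction. -/
noncomputable def cosModeNorm (ℓ : Fin 3 → ℝ) (k : Fin 3 → ℕ) : ℝ :=
  √(∫ x in box ℓ, cosMode ℓ k x * cosMode ℓ k x)

theorem sqrt_le_cosModeNorm {ℓ : Fin 3 → ℝ} (hℓ : ∀ i, 0 < ℓ i) (k : Fin 3 → ℕ) :
    √(∏ i, ℓ i / 2) ≤ cosModeNorm ℓ k :=
  Real.sqrt_le_sqrt (prod_half_le_integral_cosMode_sq hℓ k)

theorem sqrt_prod_half_pos {ℓ : Fin 3 → ℝ} (hℓ : ∀ i, 0 < ℓ i) : 0 < √(∏ i, ℓ i / 2) :=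
  Real.sqrt_pos.2 (Finset.prod_pos fun i _ => half_pos (hℓ i))

theorem cosModeNorm_pos {ℓ : Fin 3 → ℝ} (hℓ : ∀ i, 0 < ℓ i) (k : Fin 3 → ℕ) :
    0 < cosModeNorm ℓ k := (sqrt_prod_half_pos hℓ).trans_le (sqrt_le_cosModeNorm hℓ k)

theorem orthonormal_cosMode {ℓ : Fin 3 → ℝ} (hℓ : ∀ i, 0 < ℓ i) :
    Orthonormal ℝ fun k => (cosModeNorm ℓ k)⁻¹ • toL2 ℓ (cosModeC ℓ k) := by
  classical
  rw [orthonormal_iff_ite]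
  intro k m
  rw [real_inner_smul_left, real_inner_smul_right, cosModeC, cosModeC, inner_toL2]
  split_ifs with h
  · subst h
    have h1 := cosModeNorm_pos hℓ k
    have h2 : ∫ x in box ℓ, cosMode ℓ k x * cosMode ℓ k x = cosModeNorm ℓ k ^ 2 := by
      rw [cosModeNorm, Real.sq_sqrt (integral_nonneg fun x => mul_self_nonneg _)]
    rw [h2]
    field_simp
  · rw [integral_cosMode_mul_eq_zero hℓ h]; simp

/-- The orthonormal basis of `L²` of the box made of products of cosines. -/
noncomputable def cosBasis {ℓ : Fin 3 → ℝ} (hℓ : ∀ i, 0 < ℓ i) :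
    HilbertBasis (Fin 3 → ℕ) ℝ (Lp ℝ 2 (boxMeasure ℓ)) :=
  HilbertBasis.mk (orthonormal_cosMode hℓ) <| by
    have h : (Submodule.span ℝ (range fun k => toL2 ℓ (cosModeC ℓ k))).topologicalClosure = ⊤ := by
      simpa only [Submodule.map_span, ContinuousLinearMap.coe_coe, ← range_comp,
        Function.comp_def] using
        (ContinuousMap.toLp_denseRange ℝ (boxMeasure ℓ) ℝ (by simp)).topologicalClosure_map_submodule
          (span_cosModeC_topologicalClosure hℓ)
    rw [← h]
    refine Submodule.topologicalClosure_mono (Submodule.span_le.2 ?_)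
    rintro _ ⟨k, rfl⟩
    have : toL2 ℓ (cosModeC ℓ k) =
        cosModeNorm ℓ k • (cosModeNorm ℓ k)⁻¹ • toL2 ℓ (cosModeC ℓ k) := by
      rw [smul_smul, mul_inv_cancel₀ (cosModeNorm_pos hℓ k).ne', one_smul]
    beta_reduce
    rw [this]
    exact Submodule.smul_mem _ _ (Submodule.subset_span ⟨k, rfl⟩)

theorem cosBasis_apply {ℓ : Fin 3 → ℝ} (hℓ : ∀ i, 0 < ℓ i) (k : Fin 3 → ℕ) :
    cosBasis hℓ k = (cosModeNorm ℓ k)⁻¹ • toL2 ℓ (cosModeC ℓ k) := by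
  simp [cosBasis]

/-! ### The embedding into continuous functions -/

theorem inner_cosBasis {ℓ : Fin 3 → ℝ} (hℓ : ∀ i, 0 < ℓ i) (k : Fin 3 → ℕ) {f : R3 → ℝ}
    (hf : ContinuousOn f (box ℓ)) :
    ⟪cosBasis hℓ k, toL2 ℓ (boxRestrict hf)⟫_ℝ =
      (cosModeNorm ℓ k)⁻¹ * ∫ x in box ℓ, cosMode ℓ k x * f x := by
  rw [cosBasis_apply, real_inner_smul_left, cosModeC, inner_toL2]

/-- Both functions satisfy the Neumann condition, so `Δ` moves onto the eigenfunction without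
boundary terms. -/
theorem integral_cosMode_mul_sub_lap {ℓ : Fin 3 → ℝ} (hℓ : ∀ i, 0 < ℓ i) {v : R3 → ℝ}
    (hv : ContDiffOn ℝ 2 v (box ℓ)) (hn : ZeroNormalDeriv ℓ v) (k : Fin 3 → ℕ) :
    ∫ x in box ℓ, cosMode ℓ k x * (v x - lap ℓ v x) =
      (1 + eigenvalue ℓ k) * ∫ x in box ℓ, cosMode ℓ k x * v x := by
  have hl : ContinuousOn (lap ℓ v) (box ℓ) := (contDiffOn_lap hℓ hv (m := 0) (by simp)).continuousOn
  have hc := (continuous_cosMode ℓ k).continuousOn (s := box ℓ)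
  simp only [mul_sub]
  rw [integral_sub (integrableOn_box_mul hc hv.continuousOn) (integrableOn_box_mul hc hl),
    integral_mul_lap_comm hℓ hv (contDiff_cosMode ℓ k).contDiffOn hn (zeroNormalDeriv_cosMode hℓ k),
    setIntegral_congr_fun (f := fun x => v x * lap ℓ (cosMode ℓ k) x) (g := fun x => -eigenvalue ℓ k * (cosMode ℓ k x * v x))
      (measurableSet_box ℓ) fun x hx => by simp only [lap_cosMode hℓ k hx]; ring,
    integral_const_mul]
  ring

/-- The embedding of `H²` with Neumann conditions into the continuous functions. -/
theorem exists_sq_le_integral {ℓ : Fin 3 → ℝ} (hℓ : ∀ i, 0 < ℓ i) :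
    ∃ K : ℝ, 0 < K ∧ ∀ v : R3 → ℝ, ContDiffOn ℝ 2 v (box ℓ) → ZeroNormalDeriv ℓ v →
      ∀ x ∈ box ℓ, v x ^ 2 ≤ K * ∫ y in box ℓ, (v y ^ 2 + lap ℓ v y ^ 2) := by
  set M := (√(∏ i, ℓ i / 2))⁻¹
  have hM0 : 0 < M := inv_pos.2 (sqrt_prod_half_pos hℓ)
  have hs := summable_one_div_one_add_eigenvalue_sq hℓ
  set Q := ∑' k, (1 / (1 + eigenvalue ℓ k)) ^ 2
  have hQ0 : 0 < Q := hs.tsum_pos (fun k => sq_nonneg _) 0 <| by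
    have := eigenvalue_nonneg ℓ 0; positivity
  -- `M` bounds the normalising factors of the modes, `Q` comes from Cauchy–Schwarz, and `2` from
  -- `(v - Δv)² ≤ 2 (v² + (Δv)²)`.
  refine ⟨2 * M ^ 2 * Q, by positivity, fun v hv hn x hx => ?_⟩
  have hl : ContinuousOn (lap ℓ v) (box ℓ) := (contDiffOn_lap hℓ hv (m := 0) (by simp)).continuousOn
  have hw : ContinuousOn (fun x => v x - lap ℓ v x) (box ℓ) := hv.continuousOn.sub hl
  set V := boxRestrict hv.continuousOn
  set W := boxRestrict hw with hW
  set b := cosBasis hℓ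
  have hcoef : ∀ k, ⟪b k, toL2 ℓ W⟫_ℝ = (1 + eigenvalue ℓ k) * ⟪b k, toL2 ℓ V⟫_ℝ := fun k => by
    rw [inner_cosBasis, inner_cosBasis, integral_cosMode_mul_sub_lap hℓ hv hn]
    ring
  have hbes := b.orthonormal.tsum_inner_products_le (toL2 ℓ W)
  have hbess := b.orthonormal.inner_products_summable (toL2 ℓ W)
  have hW2 : ‖toL2 ℓ W‖ ^ 2 ≤ 2 * ∫ y in box ℓ, (v y ^ 2 + lap ℓ v y ^ 2) := by
    rw [← real_inner_self_eq_norm_sq, hW, inner_toL2, ← integral_const_mul]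
    refine setIntegral_mono_on (integrableOn_box_mul hw hw) (integrableOn_box
      (((hv.continuousOn.pow 2).add (hl.pow 2)).const_mul 2)) (measurableSet_box ℓ) fun y _ => ?_
    nlinarith [sq_nonneg (v y + lap ℓ v y)]
  have hholder := Real.summable_and_inner_le_Lp_mul_Lq_tsum_of_nonneg
    (f := fun k => 1 / (1 + eigenvalue ℓ k)) (g := fun k => ‖⟪b k, toL2 ℓ W⟫_ℝ‖)
    Real.HolderConjugate.two_two
    (fun k => by have := eigenvalue_nonneg ℓ k; positivity) (fun k => norm_nonneg _)
    (by simpa using hs) (by simpa using hbess)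
  have habs : ∀ k, 1 / (1 + eigenvalue ℓ k) * ‖⟪b k, toL2 ℓ W⟫_ℝ‖ = |⟪b k, toL2 ℓ V⟫_ℝ| := by
    intro k
    have := eigenvalue_nonneg ℓ k
    rw [hcoef, norm_mul, Real.norm_eq_abs, Real.norm_eq_abs, abs_of_pos (by positivity)]
    field_simp
  simp only [habs, Real.rpow_two] at hholder
  obtain ⟨hsum, hle⟩ := hholder
  set g : (Fin 3 → ℕ) → C(box ℓ, ℝ) := fun k =>
    ⟪b k, toL2 ℓ V⟫_ℝ • (cosModeNorm ℓ k)⁻¹ • cosModeC ℓ k with hg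
  have hgn : ∀ k, ‖g k‖ ≤ M * |⟪b k, toL2 ℓ V⟫_ℝ| := by
    intro k
    have h1 : ‖cosModeC ℓ k‖ ≤ 1 :=
      (ContinuousMap.norm_le _ zero_le_one).2 fun x => abs_cosMode_le_one ℓ k x
    have h2 : (cosModeNorm ℓ k)⁻¹ ≤ M :=
      inv_anti₀ (sqrt_prod_half_pos hℓ) (sqrt_le_cosModeNorm hℓ k)
    have h3 := cosModeNorm_pos hℓ k
    simp only [hg, norm_smul, norm_inv, Real.norm_eq_abs, abs_of_pos h3]
    calc |⟪b k, toL2 ℓ V⟫_ℝ| * ((cosModeNorm ℓ k)⁻¹ * ‖cosModeC ℓ k‖)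
        ≤ |⟪b k, toL2 ℓ V⟫_ℝ| * (M * 1) := by gcongr
      _ = _ := by ring
  have hgs : Summable g := Summable.of_norm_bounded (hsum.mul_left M) hgn
  -- The series `g` converges uniformly, and its image in `L²` is the basis expansion of `V`;
  -- injectivity identifies the two continuous functions.
  have hVS : V = ∑' k, g k := by
    have := isOpenPosMeasure_box hℓ
    apply ContinuousMap.toLp_injective (p := 2) (𝕜 := ℝ) (boxMeasure ℓ)
    have h1 := hgs.hasSum.mapL (toL2 ℓ)
    have h2 := b.hasSum_repr (toL2 ℓ V)
    refine h2.unique ?_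
    convert h1 using 1
    ext1 k
    rw [b.repr_apply_apply, cosBasis_apply hℓ]
    simp [hg, b, cosBasis_apply]
  have hbound : |v x| ≤ M * ∑' k, |⟪b k, toL2 ℓ V⟫_ℝ| := by
    have h1 : ‖V‖ ≤ M * ∑' k, |⟪b k, toL2 ℓ V⟫_ℝ| := by
      rw [← tsum_mul_left]
      conv_lhs => rw [hVS]
      exact tsum_of_norm_bounded (hsum.mul_left M).hasSum hgn
    exact (V.norm_coe_le_norm ⟨x, hx⟩).trans h1
  have hT0 : 0 ≤ ∑' k, |⟪b k, toL2 ℓ V⟫_ℝ| := tsum_nonneg fun k => abs_nonneg _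
  have hT : (∑' k, |⟪b k, toL2 ℓ V⟫_ℝ|) ^ 2 ≤ Q * ‖toL2 ℓ W‖ ^ 2 := by
    rw [← Real.sqrt_eq_rpow, ← Real.sqrt_eq_rpow] at hle
    calc _ ≤ (√Q * √(∑' k, ‖⟪b k, toL2 ℓ W⟫_ℝ‖ ^ 2)) ^ 2 := by gcongr
      _ = Q * ∑' k, ‖⟪b k, toL2 ℓ W⟫_ℝ‖ ^ 2 := by
        rw [mul_pow, Real.sq_sqrt hQ0.le, Real.sq_sqrt (tsum_nonneg fun k => sq_nonneg _)]
      _ ≤ _ := by gcongr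
  calc v x ^ 2 = |v x| ^ 2 := (sq_abs _).symm
    _ ≤ (M * ∑' k, |⟪b k, toL2 ℓ V⟫_ℝ|) ^ 2 := by gcongr
    _ = M ^ 2 * (∑' k, |⟪b k, toL2 ℓ V⟫_ℝ|) ^ 2 := mul_pow _ _ _
    _ ≤ M ^ 2 * (Q * (2 * ∫ y in box ℓ, (v y ^ 2 + lap ℓ v y ^ 2))) := by
      gcongr; exact hT.trans (by gcongr)
    _ = _ := by ring

/-! ### Coercivity of the energy -/

open Filter Topology

/-- With `s = 1 - η + ζ`, one has `(ε + s)² - ((ε - s)² + 4) = 4 (ε s - 1)`, and the hypothesis on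
`ζ` says `ε s > 1`. -/
theorem coercivityConst_pos {ε η ζ : ℝ} (hε : 0 < ε) (hζ : 1 / ε + η - 1 < ζ) :
    0 < coercivityConst ε η ζ := by
  have h1 : 1 / ε < 1 - η + ζ := by linarith
  have h2 : 1 < (1 - η + ζ) * ε := by rwa [div_lt_iff₀ hε] at h1
  have h3 : 0 < 1 - η + ζ := lt_trans (by positivity) h1
  have : √((ε - 1 + η - ζ) ^ 2 + 4) < ε + 1 - η + ζ := by
    rw [Real.sqrt_lt' (by linarith)]
    nlinarith
  unfold coercivityConst
  linarith

theorem coercivityConst_mul_le (ε η ζ a w : ℝ) :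
    3 / 2 * coercivityConst ε η ζ * (a ^ 2 + w ^ 2) ≤
      1 / 4 * a ^ 4 + (1 - η) / 2 * a ^ 2 + ε / 2 * w ^ 2 + a * w + ζ ^ 2 / 4 := by
  set r := √((ε - 1 + η - ζ) ^ 2 + 4) with hr
  have hr2 : r ^ 2 = (ε - 1 + η - ζ) ^ 2 + 4 := Real.sq_sqrt (by positivity)
  have hr0 : 0 ≤ r := Real.sqrt_nonneg _
  -- This is the `a²` coefficient left after subtracting the smaller eigenvalue `3/2 * C`. The
  -- remaining form is degenerate, so `p` times it is the perfect square in `hq`.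
  have hp : 0 < (1 - η + ζ - ε + r) / 4 := by
    have := abs_lt_of_sq_lt_sq (a := ε - 1 + η - ζ) (b := r) (by linarith) hr0
    linarith [(abs_lt.1 this).2]
  set p := (1 - η + ζ - ε + r) / 4 with hpdef
  have hq : p * (p * a ^ 2 + a * w + (ε / 2 - 3 / 2 * coercivityConst ε η ζ) * w ^ 2) =
      (p * a + w / 2) ^ 2 := by
    have : p * (ε / 2 - 3 / 2 * coercivityConst ε η ζ) = 1 / 4 := by
      rw [hpdef, coercivityConst, ← hr]
      linear_combination (1 / 16) * hr2
    linear_combination w ^ 2 * this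
  have hq0 : 0 ≤ p * a ^ 2 + a * w + (ε / 2 - 3 / 2 * coercivityConst ε η ζ) * w ^ 2 :=
    nonneg_of_mul_nonneg_right (hq ▸ sq_nonneg _) hp
  have hpC : p = (1 - η + ζ) / 2 - 3 / 2 * coercivityConst ε η ζ := by
    rw [hpdef, coercivityConst, ← hr]; ring
  rw [hpC] at hq0
  nlinarith [sq_nonneg (a ^ 2 - ζ)]

theorem continuousOn_lap {ℓ : Fin 3 → ℝ} (hℓ : ∀ i, 0 < ℓ i) {f : R3 → ℝ}
    (hf : ContDiffOn ℝ 2 f (box ℓ)) : ContinuousOn (lap ℓ f) (box ℓ) :=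
  (contDiffOn_lap hℓ hf (m := 0) (by simp)).continuousOn

theorem continuousOn_norm_gradientWithin_sq {ℓ : Fin 3 → ℝ} (hℓ : ∀ i, 0 < ℓ i) {f : R3 → ℝ}
    (hf : ContDiffOn ℝ 2 f (box ℓ)) :
    ContinuousOn (fun x => ‖gradientWithin f (box ℓ) x‖ ^ 2) (box ℓ) := by
  simp only [norm_gradientWithin_sq]
  exact continuousOn_finsetSum _ fun i _ =>
    (contDiffOn_pd hℓ hf (m := 1) (by norm_num) i).continuousOn.pow 2

theorem energy_eq {ε η : ℝ} {ℓ : Fin 3 → ℝ} (hℓ : ∀ i, 0 < ℓ i) {f : R3 → ℝ}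
    (hf : ContDiffOn ℝ 2 f (box ℓ)) (hn : ZeroNormalDeriv ℓ f) :
    energy ε η ℓ f = ∫ x in box ℓ, (1 / 4 * f x ^ 4 + (1 - η) / 2 * f x ^ 2
      + ε / 2 * lap ℓ f x ^ 2 + f x * lap ℓ f x) := by
  have hc := hf.continuousOn
  have hl := continuousOn_lap hℓ hf
  have hi : IntegrableOn (fun x => 1 / 4 * f x ^ 4 + (1 - η) / 2 * f x ^ 2
      + ε / 2 * lap ℓ f x ^ 2) (box ℓ) := integrableOn_box (by fun_prop)
  rw [energy, integral_sub hi (integrableOn_box (continuousOn_norm_gradientWithin_sq hℓ hf)),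
    integral_norm_gradientWithin_sq hℓ hf hn, integral_add hi (integrableOn_box_mul hc hl)]
  ring

/-- All derivatives are taken within the box. No smoothness is asked for, as `u₀` is known only
through its values there. -/
theorem energy_congr {ε η : ℝ} {ℓ : Fin 3 → ℝ} (hℓ : ∀ i, 0 < ℓ i) {f g : R3 → ℝ}
    (h : EqOn f g (box ℓ)) : energy ε η ℓ f = energy ε η ℓ g := by
  refine setIntegral_congr_fun (measurableSet_box ℓ) fun x hx => ?_
  have h1 : lap ℓ f x = lap ℓ g x := by
    rw [lap_eq_iteratedFDerivWithin hℓ f hx, lap_eq_iteratedFDerivWithin hℓ g hx]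
    simp only [iteratedFDerivWithin_congr h hx]
  have h2 : ∀ i, pd ℓ i f x = pd ℓ i g x := fun i => pd_congr h i hx
  simp only [norm_gradientWithin_sq, h hx, h2]
  simp only [lap] at h1
  rw [h1]

/-- The coercivity of the energy. -/
theorem coercivityConst_mul_integral_le {ε η ζ : ℝ} {ℓ : Fin 3 → ℝ} (hℓ : ∀ i, 0 < ℓ i)
    {f : R3 → ℝ} (hf : ContDiffOn ℝ 2 f (box ℓ)) (hn : ZeroNormalDeriv ℓ f) :
    3 / 2 * coercivityConst ε η ζ * ∫ x in box ℓ, (f x ^ 2 + lap ℓ f x ^ 2) ≤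
      energy ε η ℓ f + ζ ^ 2 / 4 * volume.real (box ℓ) := by
  have hc := hf.continuousOn
  have hl := continuousOn_lap hℓ hf
  have hi : IntegrableOn (fun x => 1 / 4 * f x ^ 4 + (1 - η) / 2 * f x ^ 2
      + ε / 2 * lap ℓ f x ^ 2 + f x * lap ℓ f x) (box ℓ) := integrableOn_box (by fun_prop)
  have hconst : ζ ^ 2 / 4 * volume.real (box ℓ) = ∫ _x in box ℓ, ζ ^ 2 / 4 := by
    rw [setIntegral_const, smul_eq_mul, mul_comm]
  rw [energy_eq hℓ hf hn, hconst, ← integral_add hi (integrableOn_box continuousOn_const),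
    ← integral_const_mul]
  exact setIntegral_mono_on (integrableOn_box (by fun_prop))
    (hi.add (integrableOn_box continuousOn_const)) (measurableSet_box ℓ)
    fun x _ => coercivityConst_mul_le ε η ζ (f x) (lap ℓ f x)

/-! ### Symmetry of the linear operator and energy differences -/

/-- The linear differential operator `εΔ² + 2Δ`. -/
noncomputable def linOp (ε : ℝ) (ℓ : Fin 3 → ℝ) (f : R3 → ℝ) (x : R3) : ℝ :=
  ε * lap ℓ (lap ℓ f) x + 2 * lap ℓ f x

theorem integral_mul_linOp {ε : ℝ} {ℓ : Fin 3 → ℝ} (hℓ : ∀ i, 0 < ℓ i) {f g : R3 → ℝ}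
    (hf : ContDiffOn ℝ 4 f (box ℓ)) (hnl : ZeroNormalDeriv ℓ (lap ℓ f))
    (hg : ContDiffOn ℝ 2 g (box ℓ)) (hng : ZeroNormalDeriv ℓ g) :
    ∫ x in box ℓ, g x * linOp ε ℓ f x =
      ε * (∫ x in box ℓ, lap ℓ f x * lap ℓ g x) + 2 * ∫ x in box ℓ, g x * lap ℓ f x := by
  have hf2 : ContDiffOn ℝ 2 (lap ℓ f) (box ℓ) := contDiffOn_lap hℓ hf (by norm_num)
  have hll := continuousOn_lap hℓ hf2
  have hl := hf2.continuousOn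
  have hc := hg.continuousOn
  rw [← integral_mul_lap_comm hℓ hf2 hg hnl hng, ← integral_const_mul, ← integral_const_mul,
    ← integral_add (integrableOn_box (by fun_prop)) (integrableOn_box (by fun_prop))]
  simp only [linOp]
  congr 1 with x
  ring

theorem integral_mul_linOp_comm {ε : ℝ} {ℓ : Fin 3 → ℝ} (hℓ : ∀ i, 0 < ℓ i) {f g : R3 → ℝ}
    (hf : ContDiffOn ℝ 4 f (box ℓ)) (hg : ContDiffOn ℝ 4 g (box ℓ))
    (hnf : ZeroNormalDeriv ℓ f) (hnf' : ZeroNormalDeriv ℓ (lap ℓ f))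
    (hng : ZeroNormalDeriv ℓ g) (hng' : ZeroNormalDeriv ℓ (lap ℓ g)) :
    ∫ x in box ℓ, g x * linOp ε ℓ f x = ∫ x in box ℓ, f x * linOp ε ℓ g x := by
  have hf2 := hf.of_le (m := 2) (by norm_num)
  have hg2 := hg.of_le (m := 2) (by norm_num)
  rw [integral_mul_linOp hℓ hf hnf' hg2 hng, integral_mul_linOp hℓ hg hng' hf2 hnf,
    integral_mul_lap_comm hℓ hf2 hg2 hnf hng]
  simp only [mul_comm (lap ℓ f _)]

theorem continuousOn_linOp {ε : ℝ} {ℓ : Fin 3 → ℝ} (hℓ : ∀ i, 0 < ℓ i) {f : R3 → ℝ}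
    (hf : ContDiffOn ℝ 4 f (box ℓ)) : ContinuousOn (linOp ε ℓ f) (box ℓ) := by
  have hf2 : ContDiffOn ℝ 2 (lap ℓ f) (box ℓ) := contDiffOn_lap hℓ hf (by norm_num)
  exact (continuousOn_const.mul (continuousOn_lap hℓ hf2)).add
    (continuousOn_const.mul hf2.continuousOn)

theorem energy_eq_linOp {ε η : ℝ} {ℓ : Fin 3 → ℝ} (hℓ : ∀ i, 0 < ℓ i) {f : R3 → ℝ}
    (hf : ContDiffOn ℝ 4 f (box ℓ)) (hn : ZeroNormalDeriv ℓ f)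
    (hn' : ZeroNormalDeriv ℓ (lap ℓ f)) :
    energy ε η ℓ f = ∫ x in box ℓ, (1 / 4 * f x ^ 4 + (1 - η) / 2 * f x ^ 2
      + 1 / 2 * (f x * linOp ε ℓ f x)) := by
  have hf2 := hf.of_le (m := 2) (by norm_num)
  have hc := hf.continuousOn
  have hl := continuousOn_lap hℓ hf2
  have hL := continuousOn_linOp (ε := ε) hℓ hf
  have hi : IntegrableOn (fun x => 1 / 4 * f x ^ 4 + (1 - η) / 2 * f x ^ 2) (box ℓ) :=
    integrableOn_box (by fun_prop)
  rw [energy_eq hℓ hf2 hn, integral_add hi (integrableOn_box (by fun_prop)), integral_const_mul,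
    integral_mul_linOp hℓ hf hn' hf2 hn,
    integral_add (integrableOn_box (by fun_prop)) (integrableOn_box (by fun_prop)),
    integral_add hi (integrableOn_box (by fun_prop)), integral_const_mul]
  simp only [pow_two (lap ℓ f _)]
  ring

/-- The quotient of the difference of the energy densities by the difference of the functions. -/
noncomputable def energyQuotient (ε η : ℝ) (ℓ : Fin 3 → ℝ) (f g : R3 → ℝ) (x : R3) : ℝ :=
  1 / 4 * (f x ^ 3 + f x ^ 2 * g x + f x * g x ^ 2 + g x ^ 3) + (1 - η) / 2 * (f x + g x)
    + 1 / 2 * (linOp ε ℓ f x + linOp ε ℓ g x)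

/-- Polarisation: for the symmetric operator `L = linOp`, `⟨f, Lf⟩ - ⟨g, Lg⟩ = ⟨f - g, Lf + Lg⟩`,
while the polynomial part factors. The difference `f - g` then appears undifferentiated. -/
theorem energy_sub_energy {ε η : ℝ} {ℓ : Fin 3 → ℝ} (hℓ : ∀ i, 0 < ℓ i) {f g : R3 → ℝ}
    (hf : ContDiffOn ℝ 4 f (box ℓ)) (hg : ContDiffOn ℝ 4 g (box ℓ))
    (hnf : ZeroNormalDeriv ℓ f) (hnf' : ZeroNormalDeriv ℓ (lap ℓ f))
    (hng : ZeroNormalDeriv ℓ g) (hng' : ZeroNormalDeriv ℓ (lap ℓ g)) :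
    energy ε η ℓ f - energy ε η ℓ g =
      ∫ x in box ℓ, (f x - g x) * energyQuotient ε η ℓ f g x := by
  have hfc := hf.continuousOn
  have hgc := hg.continuousOn
  have hLf := continuousOn_linOp (ε := ε) hℓ hf
  have hLg := continuousOn_linOp (ε := ε) hℓ hg
  have hsymm := integral_mul_linOp_comm (ε := ε) hℓ hf hg hnf hnf' hng hng'
  -- The antisymmetric cross term integrates to zero; adding it makes the two integrands agree
  -- pointwise.
  have h0 : ∫ x in box ℓ, 1 / 2 * (f x * linOp ε ℓ g x - g x * linOp ε ℓ f x) = 0 := by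
    rw [integral_const_mul, integral_sub (integrableOn_box_mul hfc hLg)
      (integrableOn_box_mul hgc hLf), hsymm]
    simp
  rw [energy_eq_linOp hℓ hf hnf hnf', energy_eq_linOp hℓ hg hng hng',
    ← integral_sub (integrableOn_box (by fun_prop)) (integrableOn_box (by fun_prop)),
    ← add_zero (∫ x in box ℓ, _), ← h0,
    ← integral_add (integrableOn_box (by fun_prop)) (integrableOn_box (by fun_prop))]
  congr 1 with x
  rw [energyQuotient]
  ring

/-! ### The energy along a solution -/

theorem continuousOn_setIntegral_box {ℓ : Fin 3 → ℝ} {S : Set ℝ} {F : ℝ × R3 → ℝ}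
    (hF : ContinuousOn F (S ×ˢ box ℓ)) : ContinuousOn (fun t => ∫ x in box ℓ, F (t, x)) S := by
  have h := continuousOn_integral_of_compact_support (μ := boxMeasure ℓ) (s := S)
    (f := fun t (x : box ℓ) => F (t, x)) isCompact_univ ?_ fun p x _ hx => absurd (mem_univ x) hx
  · refine h.congr fun t _ => ?_
    rw [boxMeasure]
    exact (integral_subtype_comap (measurableSet_box ℓ) fun x => F (t, x)).symm
  · exact hF.comp (by fun_prop) fun p hp => ⟨hp.1, p.2.2⟩

namespace IsClassicalSolution

variable {ε η : ℝ} {ℓ : Fin 3 → ℝ} {u₀ : R3 → ℝ} {u : ℝ → R3 → ℝ}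

theorem continuousOn_iteratedFDerivWithin_apply {S : Set (ℝ × R3)} {k : ℕ}
    (h : ContinuousOn (fun p : ℝ × R3 => iteratedFDerivWithin ℝ k (u p.1) (box ℓ) p.2) S)
    (m : Fin k → R3) :
    ContinuousOn (fun p : ℝ × R3 => iteratedFDerivWithin ℝ k (u p.1) (box ℓ) p.2 m) S :=
  (ContinuousMultilinearMap.apply ℝ (fun _ : Fin k => R3) ℝ m).continuous.comp_continuousOn h

theorem continuousOn_uncurry (h : IsClassicalSolution ε η ℓ u₀ u) :
    ContinuousOn (fun p : ℝ × R3 => u p.1 p.2) (Ici 0 ×ˢ box ℓ) := by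
  simpa using continuousOn_iteratedFDerivWithin_apply
    (h.continuousOn_deriv_two 0 (by norm_num)) Fin.elim0

theorem continuousOn_pd_uncurry (hℓ : ∀ i, 0 < ℓ i) (h : IsClassicalSolution ε η ℓ u₀ u)
    (i : Fin 3) : ContinuousOn (fun p : ℝ × R3 => pd ℓ i (u p.1) p.2) (Ici 0 ×ˢ box ℓ) :=
  (continuousOn_iteratedFDerivWithin_apply (h.continuousOn_deriv_two 1 (by norm_num)) _).congr
    fun p hp => pd_eq_iteratedFDerivWithin hℓ ((h.contDiffOn_two p.1 hp.1).of_le (by norm_num)) i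
      hp.2

theorem continuousOn_lap_uncurry (hℓ : ∀ i, 0 < ℓ i) (h : IsClassicalSolution ε η ℓ u₀ u) :
    ContinuousOn (fun p : ℝ × R3 => lap ℓ (u p.1) p.2) (Ici 0 ×ˢ box ℓ) :=
  (continuousOn_finsetSum _ fun _ _ => continuousOn_iteratedFDerivWithin_apply
    (h.continuousOn_deriv_two 2 le_rfl) _).congr
    fun p hp => lap_eq_iteratedFDerivWithin hℓ (u p.1) hp.2

theorem continuousOn_linOp_uncurry (hℓ : ∀ i, 0 < ℓ i) (h : IsClassicalSolution ε η ℓ u₀ u) :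
    ContinuousOn (fun p : ℝ × R3 => linOp ε ℓ (u p.1) p.2) (Ioi 0 ×ˢ box ℓ) := by
  have h1 : ContinuousOn (fun p : ℝ × R3 => lap ℓ (lap ℓ (u p.1)) p.2) (Ioi 0 ×ˢ box ℓ) :=
    (continuousOn_finsetSum _ fun i _ => continuousOn_finsetSum _ fun j _ =>
      continuousOn_iteratedFDerivWithin_apply (h.continuousOn_deriv_four 4 le_rfl) _).congr
      fun p hp => lap_lap_eq_iteratedFDerivWithin hℓ (h.contDiffOn_four p.1 hp.1) hp.2
  exact (continuousOn_const.mul h1).add (continuousOn_const.mul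
    ((continuousOn_lap_uncurry hℓ h).mono (prod_mono Ioi_subset_Ici_self Subset.rfl)))

/-- The gradient term is kept as it is: the form of the energy with `u Δu` needs the Neumann
condition, which is not assumed at `t = 0`. -/
theorem continuousOn_energy (hℓ : ∀ i, 0 < ℓ i) (h : IsClassicalSolution ε η ℓ u₀ u) :
    ContinuousOn (fun t => energy ε η ℓ (u t)) (Ici 0) := by
  have h0 := continuousOn_uncurry h
  have h1 := continuousOn_pd_uncurry hℓ h
  have h2 := continuousOn_lap_uncurry hℓ h
  refine continuousOn_setIntegral_box (F := fun p => 1 / 4 * u p.1 p.2 ^ 4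
    + (1 - η) / 2 * u p.1 p.2 ^ 2 + ε / 2 * lap ℓ (u p.1) p.2 ^ 2
    - ‖gradientWithin (u p.1) (box ℓ) p.2‖ ^ 2) ?_
  simp only [norm_gradientWithin_sq]
  fun_prop

/-- The dissipation of energy along a solution. -/
theorem hasDerivAt_energy (hℓ : ∀ i, 0 < ℓ i) (h : IsClassicalSolution ε η ℓ u₀ u) {t : ℝ}
    (ht : 0 < t) :
    HasDerivAt (fun s => energy ε η ℓ (u s))
      (∫ x in box ℓ, -(u t x ^ 3 + (1 - η) * u t x + linOp ε ℓ (u t) x) ^ 2) t := by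
  -- A compact time interval around `t` and away from `0`, on which all terms of the equation are
  -- uniformly bounded.
  set J := Icc (t / 2) (2 * t)
  have hJ : J ×ˢ box ℓ ⊆ Ioi 0 ×ˢ box ℓ :=
    prod_mono (fun s hs => lt_of_lt_of_le (half_pos ht) hs.1) Subset.rfl
  have hJ0 : ∀ s ∈ J, 0 < s := fun s hs => lt_of_lt_of_le (half_pos ht) hs.1
  have htJ : t ∈ J := ⟨by linarith, by linarith⟩
  have hJt : J ∈ 𝓝 t := Icc_mem_nhds (by linarith) (by linarith)
  have hJc : IsCompact (J ×ˢ box ℓ) := isCompact_Icc.prod (isCompact_box ℓ)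
  have hu : ContinuousOn (fun p : ℝ × R3 => u p.1 p.2) (J ×ˢ box ℓ) :=
    (continuousOn_uncurry h).mono (hJ.trans (prod_mono Ioi_subset_Ici_self Subset.rfl))
  have hL : ContinuousOn (fun p : ℝ × R3 => linOp ε ℓ (u p.1) p.2) (J ×ˢ box ℓ) :=
    (continuousOn_linOp_uncurry hℓ h).mono hJ
  have hut : ContinuousOn (fun p : ℝ × R3 => u t p.2) (J ×ˢ box ℓ) :=
    (h.contDiffOn_four t ht).continuousOn.comp continuousOn_snd fun p hp => hp.2
  have hLt : ContinuousOn (fun p : ℝ × R3 => linOp ε ℓ (u t) p.2) (J ×ˢ box ℓ) :=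
    (continuousOn_linOp hℓ (h.contDiffOn_four t ht)).comp continuousOn_snd fun p hp => hp.2
  have hR : ContinuousOn (fun p : ℝ × R3 => -(u p.1 p.2 ^ 3 + (1 - η) * u p.1 p.2
      + linOp ε ℓ (u p.1) p.2)) (J ×ˢ box ℓ) := by fun_prop
  have hG : ContinuousOn (fun p : ℝ × R3 => energyQuotient ε η ℓ (u p.1) (u t) p.2)
      (J ×ˢ box ℓ) :=
    ((continuousOn_const.mul ((((hu.pow 3).add ((hu.pow 2).mul hut)).add
      (hu.mul (hut.pow 2))).add (hut.pow 3))).add (continuousOn_const.mul (hu.add hut))).add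
      (continuousOn_const.mul (hL.add hLt))
  obtain ⟨B, hB⟩ := hJc.exists_bound_of_continuousOn hR
  obtain ⟨B', hB'⟩ := hJc.exists_bound_of_continuousOn hG
  have heq : ∀ s ∈ J, ∀ x ∈ interior (box ℓ), HasDerivAt (fun s => u s x)
      (-(u s x ^ 3 + (1 - η) * u s x + linOp ε ℓ (u s) x)) s := fun s hs x hx => by
    have := h.equation s (hJ0 s hs) x hx
    rwa [add_assoc] at this
  -- The mean value inequality turns the bound on `∂u/∂t` into a bound on difference quotients, for
  -- dominated convergence. The boundary, where the equation is not assumed, is a null set.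
  have hslope : ∀ s ∈ J, ∀ x ∈ interior (box ℓ), ‖slope (fun s => u s x) t s‖ ≤ B := by
    intro s hs x hx
    have hB0 : 0 ≤ B := (norm_nonneg _).trans (hB (t, x) ⟨htJ, interior_subset hx⟩)
    have := (convex_Icc (t / 2) (2 * t)).norm_image_sub_le_of_norm_hasDerivWithin_le
      (fun r hr => (heq r hr x hx).hasDerivWithinAt)
      (fun r hr => hB (r, x) ⟨hr, interior_subset hx⟩) htJ hs
    rw [slope_def_field, norm_div]
    exact div_le_of_le_mul₀ (norm_nonneg _) hB0 this
  rw [hasDerivAt_iff_tendsto_slope]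
  have hJt' : ∀ᶠ s in 𝓝[≠] t, s ∈ J := mem_nhdsWithin_of_mem_nhds hJt
  have hlim : Tendsto (fun s => ∫ x in box ℓ, slope (fun s => u s x) t s *
      energyQuotient ε η ℓ (u s) (u t) x) (𝓝[≠] t)
      (𝓝 (∫ x in box ℓ, -(u t x ^ 3 + (1 - η) * u t x + linOp ε ℓ (u t) x) ^ 2)) := by
    refine tendsto_integral_filter_of_dominated_convergence (fun _ => B * B') ?_ ?_
      (integrableOn_box continuousOn_const) ?_
    · filter_upwards [hJt'] with s hs
      have hus := (h.contDiffOn_four s (hJ0 s hs)).continuousOn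
      have hut := (h.contDiffOn_four t ht).continuousOn
      have hLs := continuousOn_linOp (ε := ε) hℓ (h.contDiffOn_four s (hJ0 s hs))
      have hLt := continuousOn_linOp (ε := ε) hℓ (h.contDiffOn_four t ht)
      refine ContinuousOn.aestronglyMeasurable ?_ (measurableSet_box ℓ)
      simp only [slope_def_field]
      unfold energyQuotient
      fun_prop
    · filter_upwards [hJt'] with s hs
      filter_upwards [ae_mem_interior_box ℓ] with x hx
      rw [norm_mul]
      exact mul_le_mul (hslope s hs x hx) (hB' (s, x) ⟨hs, interior_subset hx⟩) (norm_nonneg _)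
        ((norm_nonneg _).trans (hslope s hs x hx))
    · filter_upwards [ae_mem_interior_box ℓ] with x hx
      have h1 := hasDerivAt_iff_tendsto_slope.1 (heq t htJ x hx)
      have h2 : Tendsto (fun s => energyQuotient ε η ℓ (u s) (u t) x) (𝓝[≠] t)
          (𝓝 (energyQuotient ε η ℓ (u t) (u t) x)) := by
        have h3 : ContinuousOn (fun s => energyQuotient ε η ℓ (u s) (u t) x) J :=
          hG.comp (f := fun s => (s, x)) (by fun_prop) fun s hs => ⟨hs, interior_subset hx⟩
        exact (h3.continuousAt hJt).tendsto.mono_left nhdsWithin_le_nhds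
      -- On the diagonal the quotient equals `u³ + (1 - η) u + Lu`, which is `-∂u/∂t`.
      convert! h1.mul h2 using 2
      rw [energyQuotient]
      ring
  refine hlim.congr' ?_
  filter_upwards [hJt'] with s hs
  rw [slope_def_field, energy_sub_energy hℓ (h.contDiffOn_four s (hJ0 s hs))
    (h.contDiffOn_four t ht) (h.neumann s (hJ0 s hs)) (h.neumann_laplacian s (hJ0 s hs))
    (h.neumann t ht) (h.neumann_laplacian t ht), ← integral_div]
  congr 1 with x
  rw [slope_def_field]
  ring

theorem energy_le (hℓ : ∀ i, 0 < ℓ i) (h : IsClassicalSolution ε η ℓ u₀ u) {t : ℝ}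
    (ht : 0 ≤ t) : energy ε η ℓ (u t) ≤ energy ε η ℓ u₀ := by
  rw [← energy_congr hℓ fun x hx => h.initial x hx]
  refine antitoneOn_of_deriv_nonpos (convex_Ici 0) (continuousOn_energy hℓ h) ?_ ?_
    self_mem_Ici (mem_Ici.2 ht) ht
  · rw [interior_Ici]
    exact fun s hs => (hasDerivAt_energy hℓ h hs).differentiableAt.differentiableWithinAt
  · rw [interior_Ici]
    intro s hs
    rw [(hasDerivAt_energy hℓ h hs).deriv]
    exact integral_nonpos fun x => neg_nonpos.2 (sq_nonneg _)

end IsClassicalSolution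

end SwiftHohenberg

/-! ### The uniform bound -/

open Filter Topology SwiftHohenberg in
theorem mainTheorem8 (ℓ : Fin 3 → ℝ) (hℓ : ∀ i, 0 < ℓ i) :
    ∃ C' : ℝ, 0 < C' ∧
      ∀ ε η ζ : ℝ, 0 < ε → 1 / ε + η - 1 < ζ →
        0 < SwiftHohenberg.coercivityConst ε η ζ ∧
        ∀ (u₀ : SwiftHohenberg.R3 → ℝ) (u : ℝ → SwiftHohenberg.R3 → ℝ),
          SwiftHohenberg.IsClassicalSolution ε η ℓ u₀ u →
            0 ≤ SwiftHohenberg.energy ε η ℓ u₀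
                + ζ ^ 2 / 4 * volume.real (SwiftHohenberg.box ℓ) ∧
            ∀ t : ℝ, 0 ≤ t → ∀ x ∈ SwiftHohenberg.box ℓ,
              |u t x| ≤ √(C' ^ 2 / SwiftHohenberg.coercivityConst ε η ζ *
                (SwiftHohenberg.energy ε η ℓ u₀
                  + ζ ^ 2 / 4 * volume.real (SwiftHohenberg.box ℓ))) := by
  obtain ⟨K, hK, hsob⟩ := exists_sq_le_integral hℓ
  -- The embedding constant `K` divided by the factor `3/2` in front of `C_{ε,η,ζ}` in the
  -- coercivity estimate.
  refine ⟨√(2 / 3 * K), Real.sqrt_pos.2 (by positivity), fun ε η ζ hε hζ => ?_⟩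
  have hC := coercivityConst_pos hε hζ
  refine ⟨hC, fun u₀ u h => ?_⟩
  have hcoer : ∀ t, 0 < t → 3 / 2 * coercivityConst ε η ζ *
      ∫ x in box ℓ, (u t x ^ 2 + lap ℓ (u t) x ^ 2) ≤
      energy ε η ℓ u₀ + ζ ^ 2 / 4 * volume.real (box ℓ) := fun t ht =>
    (coercivityConst_mul_integral_le hℓ (h.contDiffOn_two t ht.le) (h.neumann t ht)).trans
      (by gcongr; exact h.energy_le hℓ ht.le)
  have hI : ∀ t, 0 ≤ ∫ x in box ℓ, (u t x ^ 2 + lap ℓ (u t) x ^ 2) := fun t =>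
    integral_nonneg fun x => by positivity
  -- Any positive time would do; coercivity is not available at time `0`.
  refine ⟨(mul_nonneg (by positivity) (hI 1)).trans (hcoer 1 one_pos), ?_⟩
  rw [Real.sq_sqrt (by positivity)]
  set E := energy ε η ℓ u₀ + ζ ^ 2 / 4 * volume.real (box ℓ)
  have hpos : ∀ t, 0 < t → ∀ x ∈ box ℓ,
      |u t x| ≤ √(2 / 3 * K / coercivityConst ε η ζ * E) := by
    intro t ht x hx
    refine Real.abs_le_sqrt ((hsob _ (h.contDiffOn_two t ht.le) (h.neumann t ht) x hx).trans ?_)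
    have h1 := hcoer t ht
    calc _ = 2 / 3 * K / coercivityConst ε η ζ * (3 / 2 * coercivityConst ε η ζ *
          ∫ x in box ℓ, (u t x ^ 2 + lap ℓ (u t) x ^ 2)) := by field_simp
      _ ≤ _ := by gcongr
  intro t ht x hx
  rcases ht.eq_or_lt with rfl | ht
  -- At `t = 0` the bound is the limit of the bounds for `s > 0`, whose right-hand side does not
  -- depend on `s`.
  · have hcont : ContinuousWithinAt (fun s => u s x) (Ioi 0) 0 :=
      ((h.continuousOn_uncurry.comp (f := fun s : ℝ => (s, x)) (by fun_prop)
        fun s hs => ⟨hs, hx⟩) 0 self_mem_Ici).mono Ioi_subset_Ici_self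
    exact le_of_tendsto hcont.abs (eventually_mem_nhdsWithin.mono fun s hs => hpos s hs x hx)
  · exact hpos t ht x hx
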